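/- Let $G$ be a locally compact Hausdorff étale groupoid with unit space $G^{(0)}$, domain map $d$ and range map $r$ (multiplication and inversion are continuous and $d\colon G\to G^{(0)}$ is a local homeomorphism). Assume that $G$ is topologically principal, i.e. the set of $x\in G^{(0)}$ such that the only $\alpha\in G$ with $d(\alpha)=r(\alpha)=x$ is $x$ itself is dense in $G^{(0)}$. Let $C^*_r(G)$ be the reduced groupoid C*-algebra, i.e. the completion of the convolution *-algebra $C_c(G)$ in the norm $\|f\|_r=\sup_{x\in G^{(0)}}\|\lambda_x(f)\|$, where $\lambda_x$ is the left regular representation on $\ell^2(d^{-1}(x))$, and let $C_0(G^{(0)})\subset C^*_r(G)$ be the closure of $C_c(G^{(0)})$. Let $\mathrm{Aut}(G)$ be the group of groupoid automorphisms of $G$ that are homeomorphisms, let $Z(G,\mathbb T)$ be the abelian group, under pointwise multiplication, of continuous groupoid homomorphisms $c\colon G\to\mathbb T$ into the circle group, and let $\mathrm{FAut}_{C_0(G^{(0)})}(C^*_r(G))$ be the group of *-automorphisms $\varphi$ of $C^*_r(G)$ with $\varphi(a)=a$ for all $a\in C_0(G^{(0)})$. For $\Phi\in\mathrm{Aut}(G)$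 and $c\in Z(G,\mathbb T)$ let $\varphi_{\Phi,c}$ be the *-automorphism of $C^*_r(G)$ determined by $$\varphi_{\Phi,c}(f)(\alpha)=c(\Phi^{-1}(\alpha))\,f(\Phi^{-1}(\alpha))\qquad (f\in C_c(G),\ \alpha\in G).$$ Then: 1. for all $\Phi\in\mathrm{Aut}(G)$ and $c\in Z(G,\mathbb T)$, $\Phi=\mathrm{id}_G$ holds if and only if $\varphi_{\Phi,c}\in \mathrm{FAut}_{C_0(G^{(0)})}(C^*_r(G))$; 2. the map $c\mapsto\varphi_{\mathrm{id}_G,c}$ is a group isomorphism from $Z(G,\mathbb T)$ onto $\mathrm{FAut}_{C_0(G^{(0)})}(C^*_r(G))$; 3. the group $\mathrm{FAut}_{C_0(G^{(0)})}(C^*_r(G))$ is abelian. -/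

import Mathlib

open scoped Topology ENNReal

noncomputable section

namespace EtGrpd

/-- A groupoid structure on a set `G`: a distinguished subset of units, domain and range maps onto
units, and a product `mul α β` which is meaningful only for composable pairs, i.e. when
`d α = r β` (no law constrains its value on the other pairs, and it is never used there). -/
class GroupoidStr (G : Type*) where
  units : Set G
  d : G → G
  r : G → G
  mul : G → G → G
  inv : G → G
  d_mem : ∀ α, d α ∈ units
  r_mem : ∀ α, r α ∈ units
  d_unit : ∀ x ∈ units, d x = x
  r_unit : ∀ x ∈ units, r x = x
  mul_d : ∀ α, mul α (d α) = α
  r_mul : ∀ α, mul (r α) α = α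
  d_comp : ∀ α β, d α = r β → d (mul α β) = d β
  r_comp : ∀ α β, d α = r β → r (mul α β) = r α
  assoc : ∀ α β γ, d α = r β → d β = r γ → mul (mul α β) γ = mul α (mul β γ)
  d_inv : ∀ γ, d (inv γ) = r γ
  r_inv : ∀ γ, r (inv γ) = d γ
  inv_mul : ∀ γ, mul (inv γ) γ = d γ
  mul_inv : ∀ γ, mul γ (inv γ) = r γ

open GroupoidStr

/-- A topological groupoid: multiplication (on the set of composable pairs) and inversion are
continuous. -/
class TopGroupoid (G : Type*) [TopologicalSpace G] extends GroupoidStr G where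
  continuousOn_mul : ContinuousOn (fun p : G × G => mul p.1 p.2) {p | d p.1 = r p.2}
  continuous_inv : Continuous inv

/-- The domain map with values in the subspace of units. -/
def dom {G : Type*} [GroupoidStr G] (α : G) : (units : Set G) := ⟨d α, d_mem α⟩

/-- The range map with values in the subspace of units. -/
def ran {G : Type*} [GroupoidStr G] (α : G) : (units : Set G) := ⟨r α, r_mem α⟩

/-- An étale groupoid: a topological groupoid whose domain map is a local homeomorphism onto
the unit space. (Local compactness and the Hausdorff property are assumed separately.) -/
class EtaleGroupoid (G : Type*) [TopologicalSpace G] extends TopGroupoid G where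
  isLocalHomeomorph_dom : IsLocalHomeomorph (dom : G → (units : Set G))

section Algebra

variable {G : Type*} [GroupoidStr G]

theorem d_d (α : G) : d (d α) = d α := d_unit _ (d_mem α)
theorem r_d (α : G) : r (d α) = d α := r_unit _ (d_mem α)
theorem d_r (α : G) : d (r α) = r α := d_unit _ (r_mem α)
theorem r_r (α : G) : r (r α) = r α := r_unit _ (r_mem α)

theorem inv_mul_cancel_left {α β : G} (h : d α = r β) : mul (inv α) (mul α β) = β := by
  rw [← assoc _ _ _ (d_inv α) h, inv_mul, h, r_mul]

theorem mul_inv_cancel_left {α γ : G} (h : r α = r γ) : mul α (mul (inv α) γ) = γ := by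
  rw [← assoc _ _ _ (r_inv α).symm ((d_inv α).trans h), GroupoidStr.mul_inv, h, r_mul]

theorem mul_inv_cancel_right {γ β : G} (h : d γ = d β) : mul (mul γ (inv β)) β = γ := by
  rw [assoc _ _ _ (h.trans (r_inv β).symm) (d_inv β), inv_mul, ← h, mul_d]

theorem mul_mul_inv_cancel {α β : G} (h : d α = r β) : mul (mul α β) (inv β) = α := by
  rw [assoc _ _ _ h (r_inv β).symm, GroupoidStr.mul_inv, ← h, mul_d]

theorem eq_inv_of_mul {α β : G} (h : d α = r β) (h' : mul α β = r α) : β = inv α := by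
  have h1 := inv_mul_cancel_left h
  rw [h', ← d_inv α, mul_d] at h1
  exact h1.symm

theorem inv_inv (α : G) : inv (inv α) = α :=
  (eq_inv_of_mul (d_inv α) ((inv_mul α).trans (r_inv α).symm)).symm

theorem inv_mul_inv {γ β : G} (h : d γ = d β) : inv (mul γ (inv β)) = mul β (inv γ) := by
  have h1 : d γ = r (inv β) := h.trans (r_inv β).symm
  have h2 : d β = r (inv γ) := h.symm.trans (r_inv γ).symm
  refine (eq_inv_of_mul ?_ ?_).symm
  · rw [d_comp _ _ h1, r_comp _ _ h2, d_inv]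
  · rw [assoc _ _ _ h1 (by rw [d_inv, r_comp _ _ h2]), inv_mul_cancel_left h2, GroupoidStr.mul_inv,
      r_comp _ _ h1]

end Algebra

section Top

variable {G : Type*} [TopologicalSpace G]

theorem continuous_d [EtaleGroupoid G] : Continuous (d : G → G) :=
  continuous_subtype_val.comp EtaleGroupoid.isLocalHomeomorph_dom.continuous

/-- Inversion as a homeomorphism. -/
def invHomeo (G : Type*) [TopologicalSpace G] [TopGroupoid G] : G ≃ₜ G where
  toFun := inv
  invFun := inv
  left_inv := inv_inv
  right_inv := inv_inv
  continuous_toFun := TopGroupoid.continuous_inv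
  continuous_invFun := TopGroupoid.continuous_inv

theorem isLocalHomeomorph_ran [EtaleGroupoid G] :
    IsLocalHomeomorph (ran : G → (units : Set G)) := by
  have : (ran : G → (units : Set G)) = dom ∘ invHomeo G := by
    funext α
    exact Subtype.ext (d_inv α).symm
  rw [this]
  exact EtaleGroupoid.isLocalHomeomorph_dom.comp (invHomeo G).isLocalHomeomorph

theorem continuous_r [EtaleGroupoid G] : Continuous (r : G → G) :=
  continuous_subtype_val.comp isLocalHomeomorph_ran.continuous

theorem exists_fibre_bound {X Y : Type*} [TopologicalSpace X] [TopologicalSpace Y] {p : X → Y}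
    (hp : IsLocalHomeomorph p) {K : Set X} (hK : IsCompact K) :
    ∃ N : ℕ, ∀ y, (K ∩ p ⁻¹' {y}).encard ≤ N := by
  refine hK.induction_on (p := fun s => ∃ N : ℕ, ∀ y, (s ∩ p ⁻¹' {y}).encard ≤ N) ?_ ?_ ?_ ?_
  · exact ⟨0, fun y => by simp⟩
  · rintro s t hst ⟨N, hN⟩
    exact ⟨N, fun y => (Set.encard_le_encard (Set.inter_subset_inter_left _ hst)).trans (hN y)⟩
  · rintro s t ⟨N, hN⟩ ⟨M, hM⟩
    refine ⟨N + M, fun y => ?_⟩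
    rw [Set.union_inter_distrib_right]
    refine (Set.encard_union_le _ _).trans ?_
    push_cast
    exact add_le_add (hN y) (hM y)
  · intro x _
    obtain ⟨e, hx, rfl⟩ := hp x
    refine ⟨e.source, mem_nhdsWithin_of_mem_nhds (e.open_source.mem_nhds hx), 1, fun y => ?_⟩
    simp only [Nat.cast_one, Set.encard_le_one_iff]
    rintro a b ⟨ha, ha'⟩ ⟨hb, hb'⟩
    exact e.injOn ha hb (ha'.trans hb'.symm)

end Top

section Conv

variable {G : Type*}

/-- The convolution product of functions on a groupoid: the sum of `f α * g β` over all
factorisations `γ = α β`. -/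
def convFun [GroupoidStr G] (f g : G → ℂ) (γ : G) : ℂ :=
  ∑ᶠ p : {p : G × G // d p.1 = r p.2 ∧ mul p.1 p.2 = γ}, f p.1.1 * g p.1.2

/-- Factorisations of `γ` correspond to arrows with the same range as `γ`. -/
def factorEquiv [GroupoidStr G] (γ : G) :
    {α : G // r α = r γ} ≃ {p : G × G // d p.1 = r p.2 ∧ mul p.1 p.2 = γ} where
  toFun α := ⟨(α.1, mul (inv α.1) γ), by
    rw [r_comp _ _ ((d_inv _).trans α.2), r_inv], mul_inv_cancel_left α.2⟩
  invFun p := ⟨p.1.1, (r_comp _ _ p.2.1).symm.trans (congrArg r p.2.2)⟩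
  left_inv α := rfl
  right_inv p := by
    obtain ⟨⟨α, β⟩, h, rfl⟩ := p
    exact Subtype.ext (Prod.ext rfl (inv_mul_cancel_left h))

theorem convFun_eq_sum [GroupoidStr G] {f g : G → ℂ} {γ : G} {s : Finset G}
    (hs : ∀ α, α ∈ s → r α = r γ) (hf : ∀ α, r α = r γ → f α ≠ 0 → α ∈ s) :
    convFun f g γ = ∑ α ∈ s, f α * g (mul (inv α) γ) := by
  unfold convFun
  rw [← finsum_comp_equiv (factorEquiv γ)]
  change ∑ᶠ α : {α : G // r α = r γ}, f α.1 * g (mul (inv α.1) γ) = _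
  rw [finsum_subtype_eq_finsum_cond (f := fun α => f α * g (mul (inv α) γ))
    (p := fun α => r α = r γ)]
  refine finsum_mem_eq_sum_of_inter_support_eq (s := {α | r α = r γ}) _ ?_
  ext α
  simp only [Set.mem_inter_iff, Set.mem_ofPred_eq, Function.mem_support, Finset.mem_coe]
  constructor
  · rintro ⟨h1, h2⟩
    exact ⟨hf α h1 (left_ne_zero_of_mul h2), h2⟩
  · rintro ⟨h1, h2⟩
    exact ⟨hs α h1, h2⟩

variable [TopologicalSpace G]

theorem finite_fibre [EtaleGroupoid G] (f : CompactlySupportedContinuousMap G ℂ) (x : G) :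
    {α | f α ≠ 0 ∧ r α = x}.Finite := by
  obtain ⟨N, hN⟩ := exists_fibre_bound isLocalHomeomorph_ran f.hasCompactSupport
  by_cases hx : x ∈ (units : Set G)
  · refine (Set.finite_of_encard_le_coe (hN ⟨x, hx⟩)).subset ?_
    rintro α ⟨h1, h2⟩
    exact ⟨subset_tsupport _ h1, Subtype.ext h2⟩
  · convert Set.finite_empty
    ext α
    simp only [Set.mem_ofPred_eq, Set.mem_empty_iff_false, iff_false, not_and]
    rintro - rfl
    exact hx (r_mem α)

/-- The finite set of arrows with range `x` at which `f` does not vanish. -/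
def fib [EtaleGroupoid G] (f : CompactlySupportedContinuousMap G ℂ) (x : G) : Finset G :=
  (finite_fibre f x).toFinset

theorem mem_fib [EtaleGroupoid G] {f : CompactlySupportedContinuousMap G ℂ} {x α : G} :
    α ∈ fib f x ↔ f α ≠ 0 ∧ r α = x := by
  simp [fib]

theorem convFun_eq [EtaleGroupoid G] (f : CompactlySupportedContinuousMap G ℂ) (g : G → ℂ)
    (γ : G) : convFun f g γ = ∑ α ∈ fib f (r γ), f α * g (mul (inv α) γ) :=
  convFun_eq_sum (fun _ h => (mem_fib.1 h).2) (fun _ h h' => mem_fib.2 ⟨h', h⟩)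

theorem card_fib_le [EtaleGroupoid G] (f : CompactlySupportedContinuousMap G ℂ) :
    ∃ N : ℕ, ∀ x, (fib f x).card ≤ N := by
  obtain ⟨N, hN⟩ := exists_fibre_bound isLocalHomeomorph_ran f.hasCompactSupport
  refine ⟨N, fun x => ?_⟩
  by_cases hx : ∃ α, α ∈ fib f x
  · obtain ⟨α, hα⟩ := hx
    have hx : x ∈ (units : Set G) := (mem_fib.1 hα).2 ▸ r_mem α
    have h1 : ((fib f x : Set G)).encard ≤ N := by
      refine (Set.encard_le_encard ?_).trans (hN ⟨x, hx⟩)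
      intro β hβ
      have := mem_fib.1 (Finset.mem_coe.1 hβ)
      exact ⟨subset_tsupport _ this.1, Subtype.ext this.2⟩
    rw [Set.encard_coe_eq_coe_finsetCard] at h1
    exact_mod_cast h1
  · have : fib f x = ∅ := Finset.eq_empty_of_forall_notMem fun α h => hx ⟨α, h⟩
    simp [this]

/-- Convolution by a function supported where the range map is injective is continuous. -/
theorem continuous_convFun_of_bisection [EtaleGroupoid G] [T2Space G]
    (f g : CompactlySupportedContinuousMap G ℂ)
    (e : OpenPartialHomeomorph G (units : Set G)) (he : (e : G → (units : Set G)) = ran)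
    (hf : tsupport f ⊆ e.source) : Continuous (convFun f g) := by
  have hcr : Continuous (ran : G → (units : Set G)) := isLocalHomeomorph_ran.continuous
  have hK : IsCompact (e '' tsupport f) :=
    f.hasCompactSupport.image_of_continuousOn (e.continuousOn.mono hf)
  have key1 : ∀ γ, ran γ ∈ e.target →
      convFun f g γ = f (e.symm (ran γ)) * g (mul (inv (e.symm (ran γ))) γ) := by
    intro γ hγ
    have hr : r (e.symm (ran γ)) = r γ := by
      have := e.right_inv hγ
      rw [he] at this
      exact congrArg Subtype.val this
    rw [convFun_eq_sum (s := {e.symm (ran γ)})]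
    · simp
    · intro α hα
      rw [Finset.mem_singleton.1 hα, hr]
    · intro α hα hfα
      have hα' : α ∈ e.source := hf (subset_tsupport _ hfα)
      have h2 : ran γ = e α := by
        rw [he]; exact Subtype.ext hα.symm
      rw [h2, e.left_inv hα']
      simp
  have key2 : ∀ γ, ran γ ∉ e '' tsupport f → convFun f g γ = 0 := by
    intro γ hγ
    rw [convFun_eq_sum (s := ∅)]
    · simp
    · simp
    · intro α hα hfα
      exact absurd ⟨α, subset_tsupport _ hfα, by rw [he]; exact Subtype.ext hα⟩ hγ
  rw [continuous_iff_continuousAt]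
  intro γ
  by_cases hγ : ran γ ∈ e.target
  · have hopen : IsOpen {γ : G | ran γ ∈ e.target} := e.open_target.preimage hcr
    have hs : ContinuousOn (fun γ : G => e.symm (ran γ)) {γ : G | ran γ ∈ e.target} :=
      e.continuousOn_symm.comp hcr.continuousOn fun _ h => h
    have hc : ContinuousOn (convFun f g) {γ : G | ran γ ∈ e.target} := by
      refine ContinuousOn.congr ?_ (fun γ h => key1 γ h)
      refine (f.continuous.comp_continuousOn hs).mul (g.continuous.comp_continuousOn ?_)
      refine TopGroupoid.continuousOn_mul.comp (f := fun γ : G => (inv (e.symm (ran γ)), γ))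
        ((TopGroupoid.continuous_inv.comp_continuousOn hs).prodMk continuousOn_id) ?_
      intro γ h
      have := e.right_inv h
      rw [he] at this
      exact (d_inv _).trans (congrArg Subtype.val this)
    exact hc.continuousAt (hopen.mem_nhds hγ)
  · have hopen : IsOpen {γ : G | ran γ ∉ e '' tsupport f} :=
      (hK.isClosed.preimage hcr).isOpen_compl
    have hγ' : ran γ ∉ e '' tsupport f := by
      rintro ⟨α, hα, h⟩
      exact hγ (h ▸ e.map_source (hf hα))
    refine ContinuousAt.congr (f := fun _ => (0 : ℂ)) continuousAt_const ?_
    filter_upwards [hopen.mem_nhds hγ'] with β hβ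
    exact (key2 β hβ).symm

theorem continuous_convFun [EtaleGroupoid G] [T2Space G] [LocallyCompactSpace G]
    (f g : CompactlySupportedContinuousMap G ℂ) : Continuous (convFun f g) := by
  choose e hx he using (isLocalHomeomorph_ran : IsLocalHomeomorph (ran : G → (units : Set G)))
  obtain ⟨t, ht⟩ := f.hasCompactSupport.elim_finite_subcover (fun x => (e x).source)
    (fun x => (e x).open_source) (fun x _ => Set.mem_iUnion.2 ⟨x, hx x⟩)
  obtain ⟨ψ, h1, h2, -, h4⟩ := exists_continuous_sum_one_of_isOpen_isCompact
    (s := fun i : Fin t.card => (e (t.equivFin.symm i)).source)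
    (fun i => (e _).open_source) f.hasCompactSupport (by
      refine ht.trans fun x hxt => ?_
      simp only [Set.mem_iUnion] at hxt ⊢
      obtain ⟨y, hy, hxy⟩ := hxt
      exact ⟨t.equivFin ⟨y, hy⟩, by simpa using hxy⟩)
  let F : Fin t.card → CompactlySupportedContinuousMap G ℂ := fun i =>
    { toFun := fun x => (ψ i x : ℂ) * f x
      continuous_toFun := by fun_prop
      hasCompactSupport' := f.hasCompactSupport.mul_left }
  have hF : ∀ i, tsupport (F i) ⊆ (e (t.equivFin.symm i)).source := fun i =>
    (closure_mono (fun x hx => by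
      have hx' : (ψ i x : ℂ) * f x ≠ 0 := hx
      have : (ψ i x : ℂ) ≠ 0 := left_ne_zero_of_mul hx'
      exact fun h => this (by simp [h]))).trans (h1 i)
  have hsum : convFun f g = fun γ => ∑ i, convFun (F i) g γ := by
    funext γ
    rw [convFun_eq]
    have : ∀ i, convFun (F i) g γ
        = ∑ α ∈ fib f (r γ), F i α * g (mul (inv α) γ) := fun i =>
      convFun_eq_sum (fun _ h => (mem_fib.1 h).2)
        (fun α h h' => mem_fib.2 ⟨right_ne_zero_of_mul (a := (ψ i α : ℂ)) h', h⟩)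
    simp_rw [this]
    rw [Finset.sum_comm]
    refine Finset.sum_congr rfl fun α hα => ?_
    rw [← Finset.sum_mul]
    congr 1
    have h3 := h2 (subset_tsupport f (mem_fib.1 hα).1)
    have h5 : ∑ i, (ψ i α : ℂ) = 1 := by
      have : ∑ i, ψ i α = 1 := by simpa using h3
      exact_mod_cast this
    change f α = ∑ i, (ψ i α : ℂ) * f α
    rw [← Finset.sum_mul, h5, one_mul]
  rw [hsum]
  exact continuous_finsetSum _ fun i _ =>
    continuous_convFun_of_bisection (F i) g _ (he _).symm (hF i)

theorem hasCompactSupport_convFun [EtaleGroupoid G] [T2Space G]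
    (f g : CompactlySupportedContinuousMap G ℂ) : HasCompactSupport (convFun f g) := by
  have hcl : IsClosed {p : G × G | d p.1 = r p.2} :=
    isClosed_eq (continuous_d.comp continuous_fst) (continuous_r.comp continuous_snd)
  have hK : IsCompact ((tsupport f ×ˢ tsupport g) ∩ {p : G × G | d p.1 = r p.2}) :=
    (f.hasCompactSupport.prod g.hasCompactSupport).inter_right hcl
  refine HasCompactSupport.of_support_subset_isCompact
    (hK.image_of_continuousOn (TopGroupoid.continuousOn_mul.mono Set.inter_subset_right)) ?_
  intro γ hγ
  obtain ⟨p, hp⟩ : ∃ p : {p : G × G // d p.1 = r p.2 ∧ mul p.1 p.2 = γ},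
      f p.1.1 * g p.1.2 ≠ 0 := by
    by_contra! h
    exact hγ (finsum_eq_zero_of_forall_eq_zero h)
  exact ⟨p.1, ⟨⟨subset_tsupport _ (left_ne_zero_of_mul hp),
    subset_tsupport _ (right_ne_zero_of_mul hp)⟩, p.2.1⟩, p.2.2⟩

/-- The convolution product on `C_c(G)`. -/
def conv [EtaleGroupoid G] [T2Space G] [LocallyCompactSpace G]
    (f g : CompactlySupportedContinuousMap G ℂ) :
    CompactlySupportedContinuousMap G ℂ where
  toFun := convFun f g
  continuous_toFun := continuous_convFun f g
  hasCompactSupport' := hasCompactSupport_convFun f g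

/-- The involution `f^*(γ) = conj (f (γ⁻¹))` on `C_c(G)`. -/
def invol [EtaleGroupoid G]
    (f : CompactlySupportedContinuousMap G ℂ) :
    CompactlySupportedContinuousMap G ℂ where
  toFun γ := star (f (inv γ))
  continuous_toFun := (f.continuous.comp TopGroupoid.continuous_inv).star
  hasCompactSupport' := (f.hasCompactSupport.comp_homeomorph (invHomeo G)).comp_left (star_zero ℂ)

end Conv

section Rep

variable {G : Type*}

/-- The Hilbert space `ℓ²(G)`, the orthogonal direct sum of the spaces `ℓ²(G_x)`, `x` a unit. -/
abbrev L2 (G : Type*) : Type _ := lp (fun _ : G => ℂ) 2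

/-- The standard basis vector at `α`. -/
def delta (α : G) : L2 G := by
  classical exact lp.single 2 α (1 : ℂ)

theorem delta_apply_self (α : G) : (delta α : G → ℂ) α = 1 := by
  classical
  simp [delta]

theorem delta_apply_ne {α β : G} (h : β ≠ α) : (delta α : G → ℂ) β = 0 := by
  classical
  simp [delta, h]

theorem inner_delta (α : G) (ξ : L2 G) : inner ℂ (delta α) ξ = ξ α := by
  classical
  simp [delta, lp.inner_single_left]

/-- Bounded operators on `ℓ²(G)` agreeing on the basis vectors are equal. -/
theorem opExt {S T : L2 G →L[ℂ] L2 G} (h : ∀ β, S (delta β) = T (delta β)) : S = T := by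
  classical
  ext1 ξ
  have h1 := lp.hasSum_single (by simp) ξ
  have e : ∀ β, lp.single 2 β (ξ β) = ξ β • delta β := fun β => by
    rw [delta, ← lp.single_smul]; simp
  simp_rw [e] at h1
  have hS := h1.mapL S
  have hT := h1.mapL T
  simp only [map_smul, h] at hS hT
  exact hS.unique hT

theorem sum_sq_le (ξ : L2 G) (s : Finset G) : ∑ i ∈ s, ‖ξ i‖ ^ 2 ≤ ‖ξ‖ ^ 2 := by
  have := lp.sum_rpow_le_norm_rpow (p := 2) (by simp) ξ s
  simpa using this

theorem memL2 {f : G → ℂ} {C : ℝ} (h : ∀ s : Finset G, ∑ i ∈ s, ‖f i‖ ^ 2 ≤ C) :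
    Memℓp f 2 :=
  memℓp_gen' (C := C) (by simpa using h)

theorem norm_le_of_sum {ξ : L2 G} {C : ℝ} (hC : 0 ≤ C)
    (h : ∀ s : Finset G, ∑ i ∈ s, ‖ξ i‖ ^ 2 ≤ C ^ 2) : ‖ξ‖ ≤ C :=
  lp.norm_le_of_forall_sum_le (by simp) hC (by simpa using h)

variable [TopologicalSpace G]

theorem exists_conv_bound [EtaleGroupoid G] (f : CompactlySupportedContinuousMap G ℂ) :
    ∃ C : ℝ, 0 ≤ C ∧ ∀ (ξ : L2 G) (s : Finset G),
      ∑ γ ∈ s, ‖convFun f ξ γ‖ ^ 2 ≤ (C * ‖ξ‖) ^ 2 := by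
  classical
  obtain ⟨N, hN⟩ := card_fib_le f
  obtain ⟨N', hN'⟩ := card_fib_le (invol f)
  obtain ⟨M, hM⟩ := f.hasCompactSupport.exists_bound_of_continuous f.continuous
  refine ⟨√(N * M ^ 2 * N'), Real.sqrt_nonneg _, fun ξ s => ?_⟩
  rw [mul_pow, Real.sq_sqrt (by positivity)]
  have step : ∀ γ ∈ s, ‖convFun f ξ γ‖ ^ 2
      ≤ N * M ^ 2 * ∑ α ∈ fib f (r γ), ‖ξ (mul (inv α) γ)‖ ^ 2 := by
    intro γ _
    rw [convFun_eq]
    calc ‖∑ α ∈ fib f (r γ), f α * ξ (mul (inv α) γ)‖ ^ 2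
        ≤ (∑ α ∈ fib f (r γ), ‖f α * ξ (mul (inv α) γ)‖) ^ 2 := by
          gcongr; exact norm_sum_le _ _
      _ ≤ (fib f (r γ)).card * ∑ α ∈ fib f (r γ), ‖f α * ξ (mul (inv α) γ)‖ ^ 2 :=
          sq_sum_le_card_mul_sum_sq
      _ ≤ N * ∑ α ∈ fib f (r γ), M ^ 2 * ‖ξ (mul (inv α) γ)‖ ^ 2 := by
          gcongr with α hα
          · exact_mod_cast hN _
          · rw [norm_mul, mul_pow]
            gcongr
            exact hM α
      _ = _ := by rw [← Finset.mul_sum, mul_assoc]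
  refine (Finset.sum_le_sum step).trans ?_
  rw [← Finset.mul_sum, mul_assoc _ (N' : ℝ)]
  gcongr
  rw [Finset.sum_sigma']
  set P := s.sigma fun γ => fib f (r γ) with hP
  let m : (_ : G) × G → G := fun p => mul (inv p.2) p.1
  change ∑ p ∈ P, ‖ξ (m p)‖ ^ 2 ≤ _
  rw [Finset.sum_comp (fun β => ‖ξ β‖ ^ 2) m]
  calc ∑ β ∈ P.image m, (P.filter fun p => m p = β).card • ‖ξ β‖ ^ 2
      ≤ ∑ β ∈ P.image m, N' * ‖ξ β‖ ^ 2 := by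
        refine Finset.sum_le_sum fun β _ => ?_
        rw [nsmul_eq_mul]
        gcongr
        have : (P.filter fun p => m p = β).card ≤ (fib (invol f) (r β)).card := by
          refine Finset.card_le_card_of_injOn (fun p => inv p.2) ?_ ?_
          · intro p hp
            simp only [hP, Finset.coe_filter, Finset.mem_sigma, mem_fib, Set.mem_ofPred_eq] at hp
            obtain ⟨⟨_, h1, h2⟩, h3⟩ := hp
            refine Finset.mem_coe.2 (mem_fib.2 ⟨?_, ?_⟩)
            · change star (f (inv (inv p.2))) ≠ 0
              rw [inv_inv]
              exact fun h => h1 (star_eq_zero.1 h)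
            · rw [← h3, r_comp _ _ ((d_inv _).trans h2)]
          · intro p hp q hq hpq
            simp only [hP, Finset.coe_filter, Finset.mem_sigma, mem_fib, Set.mem_ofPred_eq]
              at hp hq
            have h2 : p.2 = q.2 := by
              rw [← inv_inv p.2, ← inv_inv q.2]; exact congrArg inv hpq
            have h1 : p.1 = q.1 := by
              rw [← mul_inv_cancel_left hp.1.2.2, ← mul_inv_cancel_left hq.1.2.2]
              change mul p.2 (m p) = mul q.2 (m q)
              rw [hp.2, hq.2, h2]
            exact Sigma.ext h1 (heq_of_eq h2)
        exact_mod_cast this.trans (hN' _)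
    _ = N' * ∑ β ∈ P.image m, ‖ξ β‖ ^ 2 := by rw [Finset.mul_sum]
    _ ≤ _ := by gcongr; exact sum_sq_le _ _

/-- The (total) left regular representation `λ = ⨁ₓ λₓ` of `C_c(G)` on `ℓ²(G)`: the operator
`λ(f)` is left convolution by `f`. Each `ℓ²(G_x)` is invariant, `λ(f)` restricts there to
`λₓ(f)`, and the operator norm of `λ(f)` is the reduced norm of `f`. -/
def lam [EtaleGroupoid G] (f : CompactlySupportedContinuousMap G ℂ) : L2 G →L[ℂ] L2 G :=
  LinearMap.mkContinuousOfExistsBound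
    { toFun := fun ξ => ⟨convFun f ξ, memL2 ((exists_conv_bound f).choose_spec.2 ξ)⟩
      map_add' := fun ξ η => by
        refine lp.ext (funext fun γ => ?_)
        change convFun f (⇑(ξ + η)) γ = convFun f ξ γ + convFun f η γ
        simp only [convFun_eq, lp.coeFn_add, Pi.add_apply, mul_add, Finset.sum_add_distrib]
      map_smul' := fun a ξ => by
        refine lp.ext (funext fun γ => ?_)
        change convFun f (⇑(a • ξ)) γ = a * convFun f ξ γ
        simp only [convFun_eq, lp.coeFn_smul, Pi.smul_apply, smul_eq_mul, Finset.mul_sum]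
        exact Finset.sum_congr rfl fun _ _ => by ring }
    ⟨(exists_conv_bound f).choose, fun ξ => norm_le_of_sum
      (mul_nonneg (exists_conv_bound f).choose_spec.1 (norm_nonneg _))
      ((exists_conv_bound f).choose_spec.2 ξ)⟩

theorem lam_apply [EtaleGroupoid G] (f : CompactlySupportedContinuousMap G ℂ) (ξ : L2 G)
    (γ : G) : (lam f ξ : G → ℂ) γ = convFun f ξ γ := rfl

/-- On basis vectors, `λ(f) δ_β = ∑ f(α) δ_{αβ}`, the sum over all `α` with `d α = r β`. -/
theorem lam_delta_of_eq [EtaleGroupoid G] (f : CompactlySupportedContinuousMap G ℂ) {β γ : G}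
    (h : d β = d γ) : (lam f (delta β) : G → ℂ) γ = f (mul γ (inv β)) := by
  have hc : d γ = r (inv β) := h.symm.trans (r_inv β).symm
  rw [lam_apply, convFun_eq, Finset.sum_eq_single (mul γ (inv β))]
  · rw [inv_mul_inv h.symm, mul_inv_cancel_right h, delta_apply_self, mul_one]
  · intro α hα hne
    rw [delta_apply_ne, mul_zero]
    intro h'
    have h2 := (mem_fib.1 hα).2
    apply hne
    have h3 := mul_mul_inv_cancel (α := α) (β := mul (inv α) γ)
      (by rw [r_comp _ _ ((d_inv _).trans h2), r_inv])
    rw [mul_inv_cancel_left h2, h'] at h3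
    exact h3.symm
  · intro hn
    have : f (mul γ (inv β)) = 0 := by
      by_contra h0
      exact hn (mem_fib.2 ⟨h0, r_comp _ _ hc⟩)
    rw [this, zero_mul]

theorem lam_delta_of_ne [EtaleGroupoid G] (f : CompactlySupportedContinuousMap G ℂ) {β γ : G}
    (h : d β ≠ d γ) : (lam f (delta β) : G → ℂ) γ = 0 := by
  rw [lam_apply, convFun_eq]
  refine Finset.sum_eq_zero fun α hα => ?_
  rw [delta_apply_ne, mul_zero]
  rintro rfl
  exact h (d_comp _ _ ((d_inv _).trans (mem_fib.1 hα).2))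

theorem lam_zero [EtaleGroupoid G] :
    lam (0 : CompactlySupportedContinuousMap G ℂ) = 0 := by
  refine opExt fun β => lp.ext (funext fun γ => ?_)
  by_cases h : d β = d γ
  · rw [lam_delta_of_eq _ h]; rfl
  · rw [lam_delta_of_ne _ h]; rfl

theorem lam_add [EtaleGroupoid G] (f g : CompactlySupportedContinuousMap G ℂ) :
    lam (f + g) = lam f + lam g := by
  refine opExt fun β => lp.ext (funext fun γ => ?_)
  change _ = (lam f (delta β) : G → ℂ) γ + (lam g (delta β) : G → ℂ) γ
  by_cases h : d β = d γ
  · simp only [lam_delta_of_eq _ h]; rfl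
  · simp only [lam_delta_of_ne _ h, add_zero]

theorem lam_smul [EtaleGroupoid G] (a : ℂ) (f : CompactlySupportedContinuousMap G ℂ) :
    lam (a • f) = a • lam f := by
  refine opExt fun β => lp.ext (funext fun γ => ?_)
  change _ = a * (lam f (delta β) : G → ℂ) γ
  by_cases h : d β = d γ
  · simp only [lam_delta_of_eq _ h]; rfl
  · simp only [lam_delta_of_ne _ h, mul_zero]

theorem lam_conv [EtaleGroupoid G] [T2Space G] [LocallyCompactSpace G]
    (f g : CompactlySupportedContinuousMap G ℂ) : lam (conv f g) = lam f * lam g := by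
  refine opExt fun β => lp.ext (funext fun γ => ?_)
  change _ = (lam f (lam g (delta β)) : G → ℂ) γ
  rw [lam_apply f, convFun_eq]
  by_cases h : d β = d γ
  · have hc : d γ = r (inv β) := h.symm.trans (r_inv β).symm
    rw [lam_delta_of_eq _ h]
    change convFun f g _ = _
    rw [convFun_eq, r_comp _ _ hc]
    refine Finset.sum_congr rfl fun α hα => ?_
    have h2 := (d_inv α).trans (mem_fib.1 hα).2
    rw [lam_delta_of_eq g (h.trans (d_comp _ _ h2).symm), assoc _ _ _ h2 hc]
  · rw [lam_delta_of_ne _ h]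
    refine (Finset.sum_eq_zero fun α hα => ?_).symm
    have h2 := (d_inv α).trans (mem_fib.1 hα).2
    rw [lam_delta_of_ne g (fun h' => h (h'.trans (d_comp _ _ h2))), mul_zero]

theorem lam_invol [EtaleGroupoid G] (f : CompactlySupportedContinuousMap G ℂ) :
    lam (invol f) = star (lam f) := by
  refine opExt fun β => lp.ext (funext fun γ => ?_)
  rw [← inner_delta γ (star (lam f) (delta β)), ContinuousLinearMap.star_eq_adjoint,
    ContinuousLinearMap.adjoint_inner_right, ← inner_conj_symm, inner_delta]
  by_cases h : d β = d γ
  · rw [lam_delta_of_eq _ h, lam_delta_of_eq _ h.symm]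
    change star (f (inv (mul γ (inv β)))) = _
    rw [inv_mul_inv h.symm]
    rfl
  · rw [lam_delta_of_ne _ h, lam_delta_of_ne _ (Ne.symm h), map_zero]

end Rep

section Algebras

theorem inv_unit {G : Type*} [GroupoidStr G] {x : G} (hx : x ∈ (units : Set G)) : inv x = x := by
  refine (eq_inv_of_mul ((d_unit x hx).trans (r_unit x hx).symm) ?_).symm
  nth_rewrite 2 [← d_unit x hx]
  rw [mul_d, r_unit x hx]

theorem convFun_unit_supported {G : Type*} [GroupoidStr G] {f g : G → ℂ} (hf : ∀ α, α ∉ (units : Set G) → f α = 0)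
    (hg : ∀ α, α ∉ (units : Set G) → g α = 0) {γ : G} (hγ : γ ∉ (units : Set G)) :
    convFun f g γ = 0 := by
  refine finsum_eq_zero_of_forall_eq_zero fun ⟨⟨α, β⟩, h, h'⟩ => ?_
  by_cases hα : α ∈ (units : Set G)
  · by_cases hβ : β ∈ (units : Set G)
    · refine absurd ?_ hγ
      have e : α = β := by rw [← d_unit α hα, ← r_unit β hβ]; exact h
      have : γ = α := by
        rw [← h', ← e]
        change mul α α = α
        nth_rewrite 2 [← d_unit α hα]
        exact mul_d α
      rwa [this]
    · change f α * g β = 0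
      rw [hg β hβ, mul_zero]
  · change f α * g β = 0
    rw [hf α hα, zero_mul]


variable (G : Type*) [TopologicalSpace G] [EtaleGroupoid G] [T2Space G] [LocallyCompactSpace G]

/-- The image of `C_c(G)` in the bounded operators on `ℓ²(G)`. -/
def lamRange : NonUnitalStarSubalgebra ℂ (L2 G →L[ℂ] L2 G) where
  carrier := Set.range lam
  add_mem' := by
    rintro _ _ ⟨f, rfl⟩ ⟨g, rfl⟩
    exact ⟨f + g, lam_add f g⟩
  zero_mem' := ⟨0, lam_zero⟩
  mul_mem' := by
    rintro _ _ ⟨f, rfl⟩ ⟨g, rfl⟩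
    exact ⟨conv f g, lam_conv f g⟩
  smul_mem' := by
    rintro a _ ⟨f, rfl⟩
    exact ⟨a • f, lam_smul a f⟩
  star_mem' := by
    rintro _ ⟨f, rfl⟩
    exact ⟨invol f, lam_invol f⟩

/-- The reduced groupoid C*-algebra: the completion of `C_c(G)` in the reduced norm
`‖f‖ = ‖λ(f)‖ = supₓ ‖λₓ(f)‖`, realised as the norm closure of `λ(C_c(G))`. -/
def reducedAlg : NonUnitalStarSubalgebra ℂ (L2 G →L[ℂ] L2 G) :=
  (lamRange G).topologicalClosure

variable {G}

/-- The inclusion of `C_c(G)` into the reduced groupoid C*-algebra. -/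
def ofCc (f : CompactlySupportedContinuousMap G ℂ) : reducedAlg G :=
  ⟨lam f, (lamRange G).le_topologicalClosure ⟨f, rfl⟩⟩

variable (G)

/-- The *-subalgebra `C_c(G⁰)` of `C_c(G)` inside the reduced groupoid C*-algebra: functions
vanishing off the (clopen) unit space. -/
def unitRange : NonUnitalStarSubalgebra ℂ (reducedAlg G) where
  carrier := {a | ∃ f : CompactlySupportedContinuousMap G ℂ,
    (∀ α, α ∉ (units : Set G) → f α = 0) ∧ ofCc f = a}
  add_mem' := by
    rintro _ _ ⟨f, hf, rfl⟩ ⟨g, hg, rfl⟩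
    refine ⟨f + g, fun α hα => ?_, Subtype.ext (lam_add f g)⟩
    change f α + g α = 0
    rw [hf α hα, hg α hα, add_zero]
  zero_mem' := ⟨0, fun _ _ => rfl, Subtype.ext lam_zero⟩
  mul_mem' := by
    rintro _ _ ⟨f, hf, rfl⟩ ⟨g, hg, rfl⟩
    exact ⟨conv f g, fun α hα => convFun_unit_supported hf hg hα, Subtype.ext (lam_conv f g)⟩
  smul_mem' := by
    rintro a _ ⟨f, hf, rfl⟩
    refine ⟨a • f, fun α hα => ?_, Subtype.ext (lam_smul a f)⟩
    change a * f α = 0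
    rw [hf α hα, mul_zero]
  star_mem' := by
    rintro _ ⟨f, hf, rfl⟩
    refine ⟨invol f, fun α hα => ?_, Subtype.ext (lam_invol f)⟩
    change star (f (inv α)) = 0
    rw [hf, star_zero]
    intro h
    apply hα
    rw [← inv_inv α, inv_unit h]
    exact h

instance : ContinuousStar (reducedAlg G) :=
  ⟨(continuous_star.comp continuous_subtype_val).subtype_mk _⟩

/-- `C_0(G⁰)` inside the reduced groupoid C*-algebra: the norm closure of `C_c(G⁰)`. -/
def diagAlg : NonUnitalStarSubalgebra ℂ (reducedAlg G) :=
  (unitRange G).topologicalClosure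

end Algebras

/-- The group of automorphisms of `A` fixing every element of `D`. -/
def fixAut {A : Type*} [NonUnitalRing A] [StarRing A] [Module ℂ A]
    (D : NonUnitalStarSubalgebra ℂ A) :
    Subgroup (A ≃⋆ₐ[ℂ] A) where
  carrier := {φ | ∀ a ∈ D, φ a = a}
  one_mem' := fun _ _ => rfl
  mul_mem' := by
    intro φ ψ hφ hψ a ha
    change φ (ψ a) = a
    rw [hψ a ha, hφ a ha]
  inv_mem' := by
    intro φ hφ a ha
    change φ.symm a = a
    nth_rewrite 1 [← hφ a ha]
    exact φ.symm_apply_apply a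

/-- The restriction of an automorphism to a *-subalgebra preserved by it and by its inverse. -/
def restrictAut {A : Type*} [NonUnitalRing A] [StarRing A] [Module ℂ A]
    (S : NonUnitalStarSubalgebra ℂ A) (Θ : A ≃⋆ₐ[ℂ] A) (h : ∀ a ∈ S, Θ a ∈ S)
    (h' : ∀ a ∈ S, Θ.symm a ∈ S) : S ≃⋆ₐ[ℂ] S where
  toFun a := ⟨Θ a.1, h a.1 a.2⟩
  invFun a := ⟨Θ.symm a.1, h' a.1 a.2⟩
  left_inv a := Subtype.ext (Θ.symm_apply_apply a.1)
  right_inv a := Subtype.ext (Θ.apply_symm_apply a.1)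
  map_mul' a b := Subtype.ext (map_mul Θ a.1 b.1)
  map_add' a b := Subtype.ext (map_add Θ a.1 b.1)
  map_star' a := Subtype.ext (map_star Θ a.1)
  map_smul' t a := Subtype.ext (map_smul Θ t a.1)

theorem sum_comp_le {G : Type*} (e : G ≃ G) (c : G → Circle) (ξ : L2 G) (s : Finset G) :
    ∑ γ ∈ s, ‖(c γ : ℂ) * ξ (e γ)‖ ^ 2 ≤ ‖ξ‖ ^ 2 := by
  have : ∑ γ ∈ s, ‖(c γ : ℂ) * ξ (e γ)‖ ^ 2 = ∑ γ ∈ s.map e.toEmbedding, ‖ξ γ‖ ^ 2 := by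
    rw [Finset.sum_map]
    refine Finset.sum_congr rfl fun γ _ => ?_
    rw [norm_mul, Circle.norm_coe, one_mul]
    rfl
  rw [this]
  exact sum_sq_le _ _

section Auto

variable (G : Type*) [TopologicalSpace G]

/-- A map of groupoids is a homomorphism if it maps composable pairs to composable pairs and
preserves their products. -/
def IsGroupoidHom {G : Type*} [GroupoidStr G] (Φ : G → G) : Prop :=
  ∀ α β, d α = r β → d (Φ α) = r (Φ β) ∧ Φ (mul α β) = mul (Φ α) (Φ β)

theorem IsGroupoidHom.map_unit {G : Type*} [GroupoidStr G] {Φ : G → G} (h : IsGroupoidHom Φ)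
    {x : G} (hx : x ∈ (units : Set G)) : d (Φ x) = Φ x ∧ r (Φ x) = Φ x := by
  have h2 := h x x ((d_unit x hx).trans (r_unit x hx).symm)
  have h3 : mul x x = x := by
    nth_rewrite 2 [← d_unit x hx]
    exact mul_d _
  rw [h3] at h2
  have h4 := inv_mul_cancel_left h2.1
  rw [← h2.2, inv_mul] at h4
  exact ⟨h4, h2.1.symm.trans h4⟩

theorem IsGroupoidHom.map_d {G : Type*} [GroupoidStr G] {Φ : G → G} (h : IsGroupoidHom Φ)
    (α : G) : Φ (d α) = d (Φ α) :=
  (h.map_unit (d_mem α)).2.symm.trans (h α (d α) (r_d α).symm).1.symm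

theorem IsGroupoidHom.map_r {G : Type*} [GroupoidStr G] {Φ : G → G} (h : IsGroupoidHom Φ)
    (α : G) : Φ (r α) = r (Φ α) :=
  (h.map_unit (r_mem α)).1.symm.trans (h (r α) α (d_r α)).1

theorem IsGroupoidHom.map_inv {G : Type*} [GroupoidStr G] {Φ : G → G} (h : IsGroupoidHom Φ)
    (α : G) : Φ (inv α) = inv (Φ α) := by
  have h1 := h α (inv α) (r_inv α).symm
  refine eq_inv_of_mul h1.1 ?_
  rw [← h1.2, GroupoidStr.mul_inv, h.map_r]

/-- `Aut(G)`: the group, under composition, of homeomorphisms of `G` that are groupoid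
automorphisms. -/
def autGrp [GroupoidStr G] : Subgroup (G ≃ₜ G) where
  carrier := {Φ | IsGroupoidHom Φ}
  one_mem' := fun _ _ h => ⟨h, rfl⟩
  mul_mem' := by
    intro Φ Ψ hΦ hΨ α β h
    have h1 := hΨ α β h
    have h2 := hΦ _ _ h1.1
    exact ⟨h2.1, (congrArg Φ h1.2).trans h2.2⟩
  inv_mem' := by
    intro Φ hΦ α β h
    change d (Φ.symm α) = r (Φ.symm β) ∧ Φ.symm (mul α β) = mul (Φ.symm α) (Φ.symm β)
    have h1 : d (Φ.symm α) = r (Φ.symm β) := by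
      apply Φ.injective
      rw [IsGroupoidHom.map_d hΦ, IsGroupoidHom.map_r hΦ, Φ.apply_symm_apply,
        Φ.apply_symm_apply, h]
    refine ⟨h1, Φ.injective ?_⟩
    rw [(hΦ _ _ h1).2, Φ.apply_symm_apply, Φ.apply_symm_apply, Φ.apply_symm_apply]

/-- `Z(G, 𝕋)`: the abelian group, under pointwise product, of continuous groupoid homomorphisms
from `G` to the circle group. -/
def cocycles [GroupoidStr G] : Subgroup C(G, Circle) where
  carrier := {c | ∀ α β, d α = r β → c (mul α β) = c α * c β}
  one_mem' := fun _ _ _ => (one_mul 1).symm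
  mul_mem' := by
    intro c c' h h' α β hαβ
    change c _ * c' _ = (c _ * c' _) * (c _ * c' _)
    rw [h α β hαβ, h' α β hαβ, mul_mul_mul_comm]
  inv_mem' := by
    intro c h α β hαβ
    change (c _)⁻¹ = (c _)⁻¹ * (c _)⁻¹
    rw [h α β hαβ, _root_.mul_inv]

variable {G}

/-- The transformation `f ↦ (c f) ∘ Φ⁻¹` of `C_c(G)`. -/
def twist (Φ : G ≃ₜ G) (c : C(G, Circle)) (f : CompactlySupportedContinuousMap G ℂ) :
    CompactlySupportedContinuousMap G ℂ where
  toFun α := (c (Φ.symm α) : ℂ) * f (Φ.symm α)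
  continuous_toFun := by fun_prop
  hasCompactSupport' := (f.hasCompactSupport.comp_homeomorph Φ.symm).mul_left

/-- The inverse of the pair `(Φ, c)`. -/
def invCoc (Φ : G ≃ₜ G) (c : C(G, Circle)) : C(G, Circle) :=
  c⁻¹.comp ⟨Φ.symm, Φ.symm.continuous⟩

/-- The operator `ξ ↦ (c ξ) ∘ Φ⁻¹` on `ℓ²(G)`. -/
def twistVec (Φ : G ≃ₜ G) (c : C(G, Circle)) (ξ : L2 G) : L2 G :=
  ⟨fun γ => (c (Φ.symm γ) : ℂ) * ξ (Φ.symm γ),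
    memL2 (sum_comp_le Φ.symm.toEquiv (fun γ => c (Φ.symm γ)) ξ)⟩

theorem twistVec_apply (Φ : G ≃ₜ G) (c : C(G, Circle)) (ξ : L2 G) (γ : G) :
    (twistVec Φ c ξ : G → ℂ) γ = (c (Φ.symm γ) : ℂ) * ξ (Φ.symm γ) := rfl

theorem norm_twistVec_le (Φ : G ≃ₜ G) (c : C(G, Circle)) (ξ : L2 G) : ‖twistVec Φ c ξ‖ ≤ ‖ξ‖ :=
  norm_le_of_sum (norm_nonneg _) (sum_comp_le Φ.symm.toEquiv (fun γ => c (Φ.symm γ)) ξ)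

theorem twistVec_left_inv (Φ : G ≃ₜ G) (c : C(G, Circle)) (ξ : L2 G) :
    twistVec Φ.symm (invCoc Φ c) (twistVec Φ c ξ) = ξ := by
  refine lp.ext (funext fun γ => ?_)
  simp [twistVec_apply, invCoc]

theorem twistVec_right_inv (Φ : G ≃ₜ G) (c : C(G, Circle)) (ξ : L2 G) :
    twistVec Φ c (twistVec Φ.symm (invCoc Φ c) ξ) = ξ := by
  refine lp.ext (funext fun γ => ?_)
  simp [twistVec_apply, invCoc]

/-- The unitary `ξ ↦ (c ξ) ∘ Φ⁻¹` of `ℓ²(G)`. -/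
def twistUnitary (Φ : G ≃ₜ G) (c : C(G, Circle)) : L2 G ≃ₗᵢ[ℂ] L2 G where
  toFun := twistVec Φ c
  invFun := twistVec Φ.symm (invCoc Φ c)
  left_inv := twistVec_left_inv Φ c
  right_inv := twistVec_right_inv Φ c
  map_add' ξ η := by
    refine lp.ext (funext fun γ => ?_)
    exact mul_add _ _ _
  map_smul' a ξ := by
    refine lp.ext (funext fun γ => ?_)
    exact mul_left_comm _ _ _
  norm_map' ξ := by
    refine le_antisymm (norm_twistVec_le Φ c ξ) ?_
    have := norm_twistVec_le Φ.symm (invCoc Φ c) (twistVec Φ c ξ)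
    rwa [twistVec_left_inv] at this

theorem twistUnitary_lam [EtaleGroupoid G] (Φ : G ≃ₜ G) (c : C(G, Circle)) (hΦ : Φ ∈ autGrp G)
    (hc : c ∈ cocycles G) (f : CompactlySupportedContinuousMap G ℂ) (ξ : L2 G) :
    twistVec Φ c (lam f ξ) = lam (twist Φ c f) (twistVec Φ c ξ) := by
  refine lp.ext (funext fun γ => ?_)
  rw [twistVec_apply, lam_apply, lam_apply, convFun_eq, convFun_eq, Finset.mul_sum]
  have hr : Φ (r (Φ.symm γ)) = r γ := by
    rw [IsGroupoidHom.map_r hΦ, Φ.apply_symm_apply]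
  refine Finset.sum_bij (fun α _ => Φ α) ?_ ?_ ?_ ?_
  · intro α hα
    have h1 := mem_fib.1 hα
    refine mem_fib.2 ⟨?_, ?_⟩
    · change (c (Φ.symm (Φ α)) : ℂ) * f (Φ.symm (Φ α)) ≠ 0
      rw [Φ.symm_apply_apply]
      exact mul_ne_zero (Circle.coe_ne_zero _) h1.1
    · rw [← IsGroupoidHom.map_r hΦ, h1.2, hr]
  · intro α _ β _ h
    exact Φ.injective h
  · intro β hβ
    have h1 := mem_fib.1 hβ
    refine ⟨Φ.symm β, mem_fib.2 ⟨right_ne_zero_of_mul h1.1, ?_⟩, Φ.apply_symm_apply β⟩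
    apply Φ.injective
    rw [hr, IsGroupoidHom.map_r hΦ, Φ.apply_symm_apply, h1.2]
  · intro α hα
    have h1 := (mem_fib.1 hα).2
    have h2 : d (inv α) = r (Φ.symm γ) := (d_inv α).trans h1
    have h3 : Φ.symm (mul (inv (Φ α)) γ) = mul (inv α) (Φ.symm γ) := by
      apply Φ.injective
      rw [Φ.apply_symm_apply, (hΦ _ _ h2).2, Φ.apply_symm_apply, IsGroupoidHom.map_inv hΦ]
    have h4 : c (Φ.symm γ) = c α * c (mul (inv α) (Φ.symm γ)) := by
      rw [← hc _ _ (by rw [r_comp _ _ h2, r_inv]), mul_inv_cancel_left h1]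
    rw [twistVec_apply, h3, h4]
    change _ = ((c (Φ.symm (Φ α)) : ℂ) * f (Φ.symm (Φ α))) * _
    rw [Φ.symm_apply_apply, Circle.coe_mul]
    ring

theorem invCoc_mem [GroupoidStr G] {Φ : G ≃ₜ G} {c : C(G, Circle)} (hΦ : Φ ∈ autGrp G)
    (hc : c ∈ cocycles G) : invCoc Φ c ∈ cocycles G := by
  intro α β h
  have h1 := (autGrp G).inv_mem hΦ α β h
  exact (congrArg c⁻¹ h1.2).trans ((cocycles G).inv_mem hc _ _ h1.1)

theorem conj_lam [EtaleGroupoid G] {Φ : G ≃ₜ G} {c : C(G, Circle)} (hΦ : Φ ∈ autGrp G)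
    (hc : c ∈ cocycles G) (f : CompactlySupportedContinuousMap G ℂ) :
    (twistUnitary Φ c).conjStarAlgEquiv (lam f) = lam (twist Φ c f) := by
  ext1 ξ
  rw [LinearIsometryEquiv.conjStarAlgEquiv_apply_apply]
  refine (twistUnitary_lam Φ c hΦ hc f _).trans ?_
  exact congrArg _ (twistVec_right_inv Φ c ξ)

theorem conj_mem [EtaleGroupoid G] [T2Space G] [LocallyCompactSpace G] {Φ : G ≃ₜ G}
    {c : C(G, Circle)} (hΦ : Φ ∈ autGrp G) (hc : c ∈ cocycles G) {a : L2 G →L[ℂ] L2 G}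
    (ha : a ∈ reducedAlg G) : (twistUnitary Φ c).conjStarAlgEquiv a ∈ reducedAlg G := by
  have hcont : Continuous (twistUnitary Φ c).conjStarAlgEquiv := by
    change Continuous fun x : L2 G →L[ℂ] L2 G => (twistUnitary Φ c).conjStarAlgEquiv x
    simp_rw [LinearIsometryEquiv.conjStarAlgEquiv_apply]
    fun_prop
  refine map_mem_closure hcont ha ?_
  rintro _ ⟨f, rfl⟩
  exact ⟨twist Φ c f, (conj_lam hΦ hc f).symm⟩

theorem twistUnitary_symm (Φ : G ≃ₜ G) (c : C(G, Circle)) :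
    (twistUnitary Φ c).symm = twistUnitary Φ.symm (invCoc Φ c) :=
  LinearIsometryEquiv.ext fun _ => rfl

theorem conj_symm_mem [EtaleGroupoid G] [T2Space G] [LocallyCompactSpace G] {Φ : G ≃ₜ G}
    {c : C(G, Circle)} (hΦ : Φ ∈ autGrp G) (hc : c ∈ cocycles G) {a : L2 G →L[ℂ] L2 G}
    (ha : a ∈ reducedAlg G) : (twistUnitary Φ c).conjStarAlgEquiv.symm a ∈ reducedAlg G := by
  rw [LinearIsometryEquiv.symm_conjStarAlgEquiv, twistUnitary_symm]
  exact conj_mem ((autGrp G).inv_mem hΦ) (invCoc_mem hΦ hc) ha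

variable [EtaleGroupoid G] [T2Space G] [LocallyCompactSpace G]

/-- The automorphism `φ_{Φ,c}` of the reduced groupoid C*-algebra attached to a groupoid
automorphism `Φ` and a cocycle `c`; by `phi_ofCc` it extends `f ↦ (c f) ∘ Φ⁻¹` on `C_c(G)`. -/
def phi (Φ : autGrp G) (c : cocycles G) : reducedAlg G ≃⋆ₐ[ℂ] reducedAlg G :=
  restrictAut (reducedAlg G) (twistUnitary Φ.1 c.1).conjStarAlgEquiv
    (fun _ ha => conj_mem Φ.2 c.2 ha)
    (fun _ ha => conj_symm_mem Φ.2 c.2 ha)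

/-- `φ_{Φ,c}(f)(α) = c(Φ⁻¹(α)) f(Φ⁻¹(α))` for `f ∈ C_c(G)`. -/
theorem phi_ofCc (Φ : autGrp G) (c : cocycles G) (f : CompactlySupportedContinuousMap G ℂ) :
    phi Φ c (ofCc f) = ofCc (twist Φ.1 c.1 f) :=
  Subtype.ext (conj_lam Φ.2 c.2 f)

end Auto

/-- `G` is topologically principal: the units with trivial isotropy are dense in the unit space. -/
def IsTopologicallyPrincipal (G : Type*) [TopologicalSpace G] [GroupoidStr G] : Prop :=
  (units : Set G) ⊆ closure {x | x ∈ (units : Set G) ∧ ∀ α : G, d α = x → r α = x → α = x}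

end EtGrpd

end

/-! An element `a` of the reduced algebra is determined by a continuous function `coeff a` on `G`,
whose restriction to the fibre over a unit `x` lists the coordinates of `a δ_x`. Let `φ` fix the
diagonal. If `f` is supported in an open bisection, `f* f` lies in the diagonal, so `φ(f)* φ(f) = f*
f` and `φ(f)` has the same norm as `f` on every vector (`norm_apply_eq_of_fix`). On the fibre over
`x` the function `f` has at most one nonzero value, at some `γ₀`.

When `x` has trivial isotropy, arrows starting at `x` are separated by their ranges. Since `φ(h f) =
h φ(f)` for `h` in the diagonal, cutting down by `h` near the range of another arrow shows that
`φ(f)` also vanishes off `γ₀` on that fibre, whence `|φ(f)| = |f|` there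
(`norm_coeff_of_trivial_isotropy`). Such fibres are dense, so continuity gives `|φ(f)| = |f|` on all
of `G`. By a partition of unity, `f(γ) = 0` forces `φ(f)(γ) = 0` for every `f` in `C_c(G)`; hence
`φ(f) = c f` for a scalar function `c` of modulus one (`exists_multiplier`), and multiplicativity of
`φ` makes `c` a cocycle. This is the surjectivity in the second claim, and commutativity follows
from it.

For the first claim, testing `φ_{Φ,c}` on bump functions shows that `Φ` fixes the units. Then `γ`
and `Φ(γ)` have equal domain and range, so they agree over units with trivial isotropy, and
everywhere by density (`autGrp_eq_one`). -/

namespace EtGrpd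

open GroupoidStr

/-! ### Open bisections, bump functions and density of arrows -/

section Bisections

variable {G : Type*} [TopologicalSpace G] [EtaleGroupoid G]

/-- An open bisection: an open set on which domain and range maps are injective. -/
structure IsOpenBisection (U : Set G) : Prop where
  isOpen : IsOpen U
  injOn_d : Set.InjOn d U
  injOn_r : Set.InjOn r U

theorem exists_isOpenBisection (γ : G) : ∃ U : Set G, γ ∈ U ∧ IsOpenBisection U := by
  obtain ⟨e, he, he'⟩ := (EtaleGroupoid.isLocalHomeomorph_dom : IsLocalHomeomorph (dom (G := G))) γ
  obtain ⟨e₁, he₁, he₁'⟩ := (isLocalHomeomorph_ran : IsLocalHomeomorph (ran (G := G))) γ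
  refine ⟨e.source ∩ e₁.source, ⟨he, he₁⟩, e.open_source.inter e₁.open_source, ?_, ?_⟩
  · intro α hα β hβ h
    refine e.injOn hα.1 hβ.1 ?_
    rw [← he']
    exact Subtype.ext h
  · intro α hα β hβ h
    refine e₁.injOn hα.2 hβ.2 ?_
    rw [← he₁']
    exact Subtype.ext h

/-- If `γ` is close to a unit `x`, then `γ` and `d γ` both lie in one bisection around `x`; having
the same domain, they coincide. -/
theorem isOpen_units : IsOpen (units : Set G) := by
  rw [isOpen_iff_mem_nhds]
  intro x hx
  obtain ⟨U, hxU, hU⟩ := exists_isOpenBisection x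
  have h : d ⁻¹' U ∈ 𝓝 x :=
    continuous_d.continuousAt.preimage_mem_nhds (by rw [d_unit x hx]; exact hU.isOpen.mem_nhds hxU)
  filter_upwards [h, hU.isOpen.mem_nhds hxU] with γ h1 h2
  rw [← hU.injOn_d h1 h2 (d_d γ)]
  exact d_mem γ

omit [EtaleGroupoid G] in
theorem exists_bump [T2Space G] [LocallyCompactSpace G] {γ : G} {U : Set G} (hU : IsOpen U)
    (hγ : γ ∈ U) : ∃ f : CompactlySupportedContinuousMap G ℂ, f γ = 1 ∧ ∀ α ∉ U, f α = 0 := by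
  -- A partition of unity with a single member serves as a compactly supported Urysohn function.
  obtain ⟨ψ, h1, h2, -, h4⟩ := exists_continuous_sum_one_of_isOpen_isCompact
    (s := fun _ : Fin 1 => U) (fun _ => hU) (isCompact_singleton (x := γ))
    (by simpa using hγ)
  refine ⟨⟨⟨fun x => (ψ 0 x : ℂ), by fun_prop⟩, (h4 0).comp_left (g := Complex.ofReal) rfl⟩, ?_, ?_⟩
  · have := h2 (Set.mem_singleton γ)
    simp only [Finset.univ_unique, Finset.sum_singleton, Pi.one_apply] at this
    change (ψ 0 γ : ℂ) = 1
    exact_mod_cast this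
  · intro α hα
    change (ψ 0 α : ℂ) = 0
    have : ψ 0 α = 0 := image_eq_zero_of_notMem_tsupport fun h => hα (h1 0 h)
    exact_mod_cast this

/-- Every function in `C_c(G)` is a sum of multiples of it supported in open bisections. -/
theorem exists_bisection_decomposition [T2Space G] [LocallyCompactSpace G]
    (f : CompactlySupportedContinuousMap G ℂ) :
    ∃ (n : ℕ) (F : Fin n → CompactlySupportedContinuousMap G ℂ), f = ∑ i, F i ∧
      ∀ i, (∀ γ, f γ = 0 → F i γ = 0) ∧
        ∃ U : Set G, IsOpenBisection U ∧ ∀ α ∉ U, F i α = 0 := by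
  choose U hx hU using exists_isOpenBisection (G := G)
  obtain ⟨t, ht⟩ := f.hasCompactSupport.elim_finite_subcover U
    (fun x => (hU x).isOpen) (fun x _ => Set.mem_iUnion.2 ⟨x, hx x⟩)
  obtain ⟨ψ, h1, h2, -, h4⟩ := exists_continuous_sum_one_of_isOpen_isCompact
    (s := fun i : Fin t.card => U (t.equivFin.symm i))
    (fun i => (hU _).isOpen) f.hasCompactSupport (by
      refine ht.trans fun x hxt => ?_
      simp only [Set.mem_iUnion] at hxt ⊢
      obtain ⟨y, hy, hxy⟩ := hxt
      exact ⟨t.equivFin ⟨y, hy⟩, by simpa using hxy⟩)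
  let F : Fin t.card → CompactlySupportedContinuousMap G ℂ := fun i =>
    { toFun := fun x => (ψ i x : ℂ) * f x
      continuous_toFun := by fun_prop
      hasCompactSupport' := f.hasCompactSupport.mul_left }
  have hF : ∀ i α, F i α = (ψ i α : ℂ) * f α := fun _ _ => rfl
  refine ⟨t.card, F, ?_, fun i => ⟨fun γ h => by rw [hF, h, mul_zero],
    U (t.equivFin.symm i), hU _, fun α hα => ?_⟩⟩
  · ext α
    rw [CompactlySupportedContinuousMap.sum_apply]
    simp only [hF]
    rw [← Finset.sum_mul]
    -- The `ψ i` need not sum to one off the support of `f`, but there both sides vanish.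
    by_cases h : f α = 0
    · rw [h, mul_zero]
    · have h3 := h2 (subset_tsupport f h)
      have h5 : ∑ i, (ψ i α : ℂ) = 1 := by
        have : ∑ i, ψ i α = 1 := by simpa using h3
        exact_mod_cast this
      rw [h5, one_mul]
  · have : ψ i α = 0 := image_eq_zero_of_notMem_tsupport fun h => hα (h1 i h)
    rw [hF, this, Complex.ofReal_zero, zero_mul]

/-- The square `f^* f` of a function supported in a bisection lives on the units. -/
theorem conv_invol_self_unit_supported [T2Space G] [LocallyCompactSpace G]
    {f : CompactlySupportedContinuousMap G ℂ} {U : Set G} (hU : IsOpenBisection U)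
    (hf : ∀ α ∉ U, f α = 0) {γ : G} (hγ : γ ∉ (units : Set G)) : conv (invol f) f γ = 0 := by
  refine finsum_eq_zero_of_forall_eq_zero fun ⟨⟨α, β⟩, h, h'⟩ => ?_
  change star (f (inv α)) * f β = 0
  by_contra h0
  have h1 : inv α ∈ U := by
    by_contra h1
    exact h0 (by rw [hf _ h1, star_zero, zero_mul])
  have h2 : β ∈ U := by
    by_contra h2
    exact h0 (by rw [hf _ h2, mul_zero])
  have h3 : inv α = β := hU.injOn_r h1 h2 ((r_inv α).trans h)
  apply hγ
  have h4 : mul α β = γ := h'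
  rw [← h4, ← h3, GroupoidStr.mul_inv]
  exact r_mem α

/-- In a topologically principal groupoid the arrows starting at units with trivial isotropy are
dense. -/
theorem IsTopologicallyPrincipal.dense_arrows (hG : IsTopologicallyPrincipal G) :
    Dense {γ : G | ∀ α : G, d α = d γ → r α = d γ → α = d γ} := by
  have h : Dense {x : (units : Set G) | ∀ α : G, d α = x.1 → r α = x.1 → α = x.1} := by
    rw [Subtype.dense_iff]
    refine hG.trans (closure_mono ?_)
    rintro x ⟨hx, h⟩
    exact ⟨⟨x, hx⟩, h, rfl⟩
  exact h.preimage EtaleGroupoid.isLocalHomeomorph_dom.isOpenMap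

end Bisections

/-! ### Coefficient functions of elements of the reduced algebra -/

section Coefficients

variable {G : Type*} [TopologicalSpace G] [EtaleGroupoid G] [T2Space G] [LocallyCompactSpace G]

theorem continuous_starAlgEquiv {A : Type*} [NonUnitalCStarAlgebra A] (φ : A ≃⋆ₐ[ℂ] A) :
    Continuous φ := (StarAlgEquiv.isometry φ).continuous

/-- Closedness, picked up by instance search, makes `S` a C*-algebra, and *-automorphisms of
C*-algebras are isometric. -/
theorem continuous_starAlgEquiv_subalgebra {B : Type*} [CStarAlgebra B]
    {S : NonUnitalStarSubalgebra ℂ B} (hS : IsClosed (S : Set B)) (φ : S ≃⋆ₐ[ℂ] S) :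
    Continuous φ :=
  continuous_starAlgEquiv (A := S) φ

theorem continuous_reducedAlg_aut (φ : reducedAlg G ≃⋆ₐ[ℂ] reducedAlg G) : Continuous φ :=
  continuous_starAlgEquiv_subalgebra isClosed_closure φ

/-- The function on `G` attached to an operator in the reduced C*-algebra. -/
noncomputable def coeff (a : reducedAlg G) (γ : G) : ℂ := (a.1 (delta (d γ)) : G → ℂ) γ

omit [TopologicalSpace G] [EtaleGroupoid G] [T2Space G] [LocallyCompactSpace G] in
theorem continuous_matrix_coeff (β γ : G) :
    Continuous fun a : L2 G →L[ℂ] L2 G => (a (delta β) : G → ℂ) γ := by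
  simp_rw [← inner_delta γ]
  fun_prop

theorem reducedAlg_isClosed_induction {p : (L2 G →L[ℂ] L2 G) → Prop} (hp : IsClosed {a | p a})
    (h : ∀ f, p (lam f)) (a : reducedAlg G) : p a.1 := by
  have h1 : closure (Set.range lam) ⊆ {a | p a} := hp.closure_subset_iff.2 (by
    rintro _ ⟨f, rfl⟩
    exact h f)
  exact h1 a.2

theorem coeff_ofCc (f : CompactlySupportedContinuousMap G ℂ) (γ : G) :
    coeff (ofCc f) γ = f γ := by
  change (lam f (delta (d γ)) : G → ℂ) γ = f γ
  rw [lam_delta_of_eq f (d_d γ), inv_unit (d_mem γ), mul_d]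

/-- Left convolution commutes with right translation, so a matrix entry depends only on `γ β⁻¹`.
This holds for each `lam f` and is a closed condition on the operator. -/
theorem apply_delta_of_eq (a : reducedAlg G) {β γ : G} (h : d β = d γ) :
    (a.1 (delta β) : G → ℂ) γ = coeff a (mul γ (inv β)) := by
  refine reducedAlg_isClosed_induction (p := fun a => (a (delta β) : G → ℂ) γ
    = (a (delta (d (mul γ (inv β)))) : G → ℂ) (mul γ (inv β)))
    (isClosed_eq (continuous_matrix_coeff _ _) (continuous_matrix_coeff _ _)) (fun f => ?_) a
  rw [lam_delta_of_eq f h]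
  exact (coeff_ofCc f _).symm

theorem apply_delta_of_ne (a : reducedAlg G) {β γ : G} (h : d β ≠ d γ) :
    (a.1 (delta β) : G → ℂ) γ = 0 :=
  reducedAlg_isClosed_induction (p := fun a => (a (delta β) : G → ℂ) γ = 0)
    (isClosed_eq (continuous_matrix_coeff _ _) continuous_const)
    (fun f => lam_delta_of_ne f h) a

/-- Every matrix entry of an element is either one of its coefficients or zero. -/
theorem coeff_injective : Function.Injective (coeff : reducedAlg G → G → ℂ) := by
  intro a b h
  refine Subtype.ext (opExt fun β => lp.ext (funext fun γ => ?_))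
  by_cases hβ : d β = d γ
  · rw [apply_delta_of_eq a hβ, apply_delta_of_eq b hβ, h]
  · rw [apply_delta_of_ne a hβ, apply_delta_of_ne b hβ]

theorem coeff_add (a b : reducedAlg G) (γ : G) : coeff (a + b) γ = coeff a γ + coeff b γ := rfl

theorem coeff_map_smul (φ : reducedAlg G ≃⋆ₐ[ℂ] reducedAlg G) (t : ℂ)
    (f : CompactlySupportedContinuousMap G ℂ) (γ : G) :
    coeff (φ (ofCc (t • f))) γ = t * coeff (φ (ofCc f)) γ := by
  let _ : SMul ℂ (reducedAlg G) := (reducedAlg G).instModule.toSMul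
  have h : ofCc (t • f) = t • ofCc f := Subtype.ext (lam_smul t f)
  rw [h]
  exact congrArg (fun a => coeff a γ) (φ.map_smul' t (ofCc f))

omit [TopologicalSpace G] [EtaleGroupoid G] [T2Space G] [LocallyCompactSpace G] in
theorem norm_delta (β : G) : ‖(delta β : L2 G)‖ = 1 := by
  classical
  rw [delta, lp.norm_single (by simp)]
  simp

omit [TopologicalSpace G] [EtaleGroupoid G] [T2Space G] [LocallyCompactSpace G] in
theorem norm_apply_delta_le (a : L2 G →L[ℂ] L2 G) (β γ : G) :
    ‖(a (delta β) : G → ℂ) γ‖ ≤ ‖a‖ := by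
  refine (lp.norm_apply_le_norm (by simp) _ _).trans ?_
  simpa [norm_delta] using a.le_opNorm (delta β)

/-- Coefficients are bounded by the operator norm, so `coeff a` is a uniform limit of functions in
`C_c(G)`. -/
theorem continuous_coeff (a : reducedAlg G) : Continuous (coeff a) := by
  refine continuous_of_uniform_approx_of_continuous fun u hu => ?_
  obtain ⟨ε, hε, h⟩ := Metric.mem_uniformity_dist.1 hu
  have ha : a.1 ∈ closure (Set.range lam) := a.2
  obtain ⟨_, ⟨f, rfl⟩, hf⟩ := Metric.mem_closure_iff.1 ha ε hε
  refine ⟨f, f.continuous, fun γ => h ?_⟩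
  rw [← coeff_ofCc f γ, dist_eq_norm]
  rw [dist_eq_norm] at hf
  exact (norm_apply_delta_le (a.1 - lam f) (d γ) γ).trans_lt hf

-- The only unit with range `r γ` is `r γ` itself, so a single factorisation of `γ` contributes.
-- Thus the diagonal acts from the left through ranges, which is what lets it separate arrows with a
-- common domain.
omit [T2Space G] [LocallyCompactSpace G] in
theorem convFun_of_unit_supported {h ξ : G → ℂ} (hh : ∀ α ∉ (units : Set G), h α = 0) (γ : G) :
    convFun h ξ γ = h (r γ) * ξ γ := by
  rw [convFun_eq_sum (s := {r γ})]
  · rw [Finset.sum_singleton, inv_unit (r_mem γ), r_mul]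
  · intro α hα
    rw [Finset.mem_singleton.1 hα, r_r]
  · intro α hα h0
    have : α ∈ (units : Set G) := by
      by_contra h1
      exact h0 (hh α h1)
    rw [Finset.mem_singleton, ← hα, r_unit α this]

theorem ofCc_mem_diagAlg {h : CompactlySupportedContinuousMap G ℂ}
    (hh : ∀ α ∉ (units : Set G), h α = 0) : ofCc h ∈ diagAlg G :=
  (unitRange G).le_topologicalClosure ⟨h, hh, rfl⟩

end Coefficients

/-! ### Automorphisms fixing the diagonal preserve absolute values -/

section FixingAutomorphisms

variable {G : Type*} [TopologicalSpace G] [EtaleGroupoid G] [T2Space G] [LocallyCompactSpace G]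

/-- The squared norm of `b ξ` is `⟨ξ, b* b ξ⟩`, and `φ(a)* φ(a) = φ(a* a) = a* a`. -/
theorem norm_apply_eq_of_fix {φ : reducedAlg G ≃⋆ₐ[ℂ] reducedAlg G} (hφ : φ ∈ fixAut (diagAlg G))
    {a : reducedAlg G} (ha : star a * a ∈ diagAlg G) (ξ : L2 G) :
    ‖(φ a).1 ξ‖ = ‖a.1 ξ‖ := by
  have key : ∀ b : reducedAlg G, ‖b.1 ξ‖ ^ 2 = RCLike.re (inner ℂ ξ ((star b * b).1 ξ)) :=
    fun b => ContinuousLinearMap.apply_norm_sq_eq_inner_adjoint_right b.1 ξ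
  have h : star (φ a) * φ a = star a * a := by
    rw [show star (φ a) = φ (star a) from (φ.map_star' a).symm, ← map_mul]
    exact hφ _ ha
  have h2 := key (φ a)
  rw [h, ← key a] at h2
  exact (sq_eq_sq₀ (norm_nonneg _) (norm_nonneg _)).1 h2

theorem star_mul_self_mem_diagAlg {f : CompactlySupportedContinuousMap G ℂ} {U : Set G}
    (hU : IsOpenBisection U) (hf : ∀ α ∉ U, f α = 0) :
    star (ofCc f) * ofCc f ∈ diagAlg G := by
  have h : ofCc (conv (invol f) f) = star (ofCc f) * ofCc f := by
    refine Subtype.ext ((lam_conv _ _).trans ?_)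
    rw [lam_invol]
    rfl
  rw [← h]
  exact ofCc_mem_diagAlg fun γ hγ => conv_invol_self_unit_supported hU hf hγ

/-- If `f` vanishes on the fibre over `d γ`, it kills the basis vector at `d γ`; by equality of
norms so does `φ(f)`. No condition on isotropy enters. -/
theorem coeff_eq_zero_of_vanish {φ : reducedAlg G ≃⋆ₐ[ℂ] reducedAlg G}
    (hφ : φ ∈ fixAut (diagAlg G)) {f : CompactlySupportedContinuousMap G ℂ} {U : Set G}
    (hU : IsOpenBisection U) (hf : ∀ α ∉ U, f α = 0) {γ : G}
    (h : ∀ α, d α = d γ → f α = 0) : coeff (φ (ofCc f)) γ = 0 := by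
  have h1 := norm_apply_eq_of_fix hφ (star_mul_self_mem_diagAlg hU hf) (delta (d γ))
  have h2 : (ofCc f).1 (delta (d γ)) = 0 := by
    refine lp.ext (funext fun α => ?_)
    by_cases hα : d α = d γ
    · have h3 := coeff_ofCc f α
      rw [coeff, hα, h α hα] at h3
      exact h3
    · exact apply_delta_of_ne (ofCc f) (by rw [d_d]; exact Ne.symm hα)
  rw [h2, norm_zero, norm_eq_zero] at h1
  rw [coeff, h1]
  rfl

theorem coeff_ofCc_mul {h : CompactlySupportedContinuousMap G ℂ}
    (hh : ∀ α ∉ (units : Set G), h α = 0) (a : reducedAlg G) (γ : G) :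
    coeff (ofCc h * a) γ = h (r γ) * coeff a γ :=
  convFun_of_unit_supported hh γ

/-- Over a unit with trivial isotropy, multiplication by the diagonal confines `φ(f)` to the one
arrow of the fibre where `f` can be nonzero; equality of norms at the basis vector then compares two
single coefficients. -/
theorem norm_coeff_of_trivial_isotropy {φ : reducedAlg G ≃⋆ₐ[ℂ] reducedAlg G}
    (hφ : φ ∈ fixAut (diagAlg G)) {f : CompactlySupportedContinuousMap G ℂ} {U : Set G}
    (hU : IsOpenBisection U) (hf : ∀ α ∉ U, f α = 0) {γ : G}
    (hγ : ∀ α : G, d α = d γ → r α = d γ → α = d γ) :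
    ‖coeff (φ (ofCc f)) γ‖ = ‖f γ‖ := by
  by_cases h0 : ∀ α, d α = d γ → f α = 0
  · rw [coeff_eq_zero_of_vanish hφ hU hf h0, h0 γ rfl]
  push Not at h0
  obtain ⟨γ₀, hd, hγ₀⟩ := h0
  have mem_U : ∀ α, f α ≠ 0 → α ∈ U := fun α hα => by
    by_contra h
    exact hα (hf α h)
  have uniq : ∀ α, d α = d γ → f α ≠ 0 → α = γ₀ := fun α h1 h2 =>
    hU.injOn_d (mem_U α h2) (mem_U γ₀ hγ₀) (h1.trans hd.symm)
  have vanish : ∀ α, d α = d γ → α ≠ γ₀ → coeff (φ (ofCc f)) α = 0 := by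
    intro α hα hne
    -- With equal ranges, `γ₀⁻¹ α` would be an isotropy arrow at `d γ`, hence a unit.
    have hr : r α ≠ r γ₀ := by
      intro hr
      apply hne
      have h1 : d (inv γ₀) = r α := (d_inv γ₀).trans hr.symm
      have h2 := hγ (mul (inv γ₀) α) ((d_comp _ _ h1).trans hα)
        ((r_comp _ _ h1).trans ((r_inv γ₀).trans hd))
      have h3 := mul_inv_cancel_left (α := γ₀) (γ := α) hr.symm
      rw [h2, ← hd, mul_d] at h3
      exact h3.symm
    -- The cut-off is 1 at `r α` and 0 at `r γ₀`, so `h f` vanishes on the whole fibre while `h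
    -- φ(f)` keeps its value at `α`.
    obtain ⟨h, hh1, hh2⟩ := exists_bump (G := G) (γ := r α) (U := units ∩ {r γ₀}ᶜ)
      (isOpen_units.inter isOpen_compl_singleton) ⟨r_mem α, hr⟩
    have hu : ∀ β ∉ (units : Set G), h β = 0 := fun β hβ => hh2 β fun h' => hβ h'.1
    have hmul : ∀ β, conv h f β = h (r β) * f β := convFun_of_unit_supported hu
    have h3 : coeff (φ (ofCc (conv h f))) α = 0 := by
      refine coeff_eq_zero_of_vanish hφ hU (fun β hβ => by rw [hmul, hf β hβ, mul_zero]) ?_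
      intro β hβ
      rw [hmul]
      by_cases hβ0 : f β = 0
      · rw [hβ0, mul_zero]
      · rw [uniq β (hβ.trans hα) hβ0, hh2 _ (fun h' => h'.2 rfl), zero_mul]
    have h4 : ofCc (conv h f) = ofCc h * ofCc f := Subtype.ext (lam_conv h f)
    rw [h4, map_mul, hφ _ (ofCc_mem_diagAlg hu), coeff_ofCc_mul hu, hh1, one_mul] at h3
    exact h3
  by_cases hγγ : γ = γ₀
  · subst hγγ
    -- An element concentrated at `γ` on this fibre sends the basis vector at `d γ` to a multiple of
    -- `delta γ`. This applies to both `φ(f)` and `f`.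
    have conc : ∀ a : reducedAlg G, (∀ α, d α = d γ → α ≠ γ → coeff a α = 0) →
        ‖a.1 (delta (d γ))‖ = ‖coeff a γ‖ := by
      intro a ha
      have : a.1 (delta (d γ)) = coeff a γ • delta γ := by
        refine lp.ext (funext fun α => ?_)
        change _ = coeff a γ * (delta γ : G → ℂ) α
        by_cases h1 : α = γ
        · rw [h1, delta_apply_self, mul_one, coeff]
        · rw [delta_apply_ne h1, mul_zero]
          by_cases h2 : d α = d γ
          · rw [← h2]
            exact ha α h2 h1
          · exact apply_delta_of_ne a (by rw [d_d]; exact Ne.symm h2)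
      rw [this, norm_smul, norm_delta, mul_one]
    have h1 := norm_apply_eq_of_fix hφ (star_mul_self_mem_diagAlg hU hf) (delta (d γ))
    rw [conc _ vanish, conc, coeff_ofCc] at h1
    · exact h1
    · intro α h2 h3
      rw [coeff_ofCc]
      by_contra h4
      exact h3 (uniq α h2 h4)
  · rw [vanish γ rfl hγγ]
    have : f γ = 0 := by
      by_contra h
      exact hγγ (uniq γ rfl h)
    rw [this]

/-- Both sides are continuous in `γ` and agree on the dense set of arrows starting at units with
trivial isotropy. -/
theorem norm_coeff_of_bisection (hG : IsTopologicallyPrincipal G)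
    {φ : reducedAlg G ≃⋆ₐ[ℂ] reducedAlg G}
    (hφ : φ ∈ fixAut (diagAlg G)) {f : CompactlySupportedContinuousMap G ℂ} {U : Set G}
    (hU : IsOpenBisection U) (hf : ∀ α ∉ U, f α = 0) (γ : G) :
    ‖coeff (φ (ofCc f)) γ‖ = ‖f γ‖ :=
  congrFun (Continuous.ext_on hG.dense_arrows (continuous_coeff _).norm f.continuous.norm
    fun _ h => norm_coeff_of_trivial_isotropy hφ hU hf h) γ

/-- The identity of absolute values is available only for bisection-supported functions, so `f` is
cut into such pieces, each still vanishing at `γ`. -/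
theorem coeff_eq_zero_of_fix (hG : IsTopologicallyPrincipal G)
    {φ : reducedAlg G ≃⋆ₐ[ℂ] reducedAlg G}
    (hφ : φ ∈ fixAut (diagAlg G)) {f : CompactlySupportedContinuousMap G ℂ} {γ : G}
    (hf : f γ = 0) : coeff (φ (ofCc f)) γ = 0 := by
  obtain ⟨n, F, hsum, hF⟩ := exists_bisection_decomposition f
  let L : CompactlySupportedContinuousMap G ℂ →+ ℂ :=
    { toFun := fun f => coeff (φ (ofCc f)) γ
      map_zero' := by
        rw [show ofCc (0 : CompactlySupportedContinuousMap G ℂ) = 0 from Subtype.ext lam_zero,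
          map_zero]
        rfl
      map_add' := fun f g => by
        rw [show ofCc (f + g) = ofCc f + ofCc g from Subtype.ext (lam_add f g), map_add, coeff_add] }
  change L f = 0
  rw [hsum, map_sum]
  refine Finset.sum_eq_zero fun i _ => ?_
  obtain ⟨h1, U, hU, h2⟩ := hF i
  have h3 := norm_coeff_of_bisection hG hφ hU h2 γ
  rw [h1 γ hf, norm_zero, norm_eq_zero] at h3
  exact h3

/-! ### The multiplier of an automorphism and its cocycle identity -/

theorem exists_bisection_bump (γ : G) : ∃ f : CompactlySupportedContinuousMap G ℂ, f γ = 1 ∧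
    ∃ U : Set G, IsOpenBisection U ∧ ∀ α ∉ U, f α = 0 := by
  obtain ⟨U, hγ, hU⟩ := exists_isOpenBisection γ
  obtain ⟨f, h1, h2⟩ := exists_bump hU.isOpen hγ
  exact ⟨f, h1, U, hU, h2⟩

/-- An automorphism fixing the diagonal acts on coefficient functions by multiplication. -/
theorem exists_multiplier (hG : IsTopologicallyPrincipal G)
    {φ : reducedAlg G ≃⋆ₐ[ℂ] reducedAlg G} (hφ : φ ∈ fixAut (diagAlg G)) :
    ∃ c : C(G, Circle), ∀ (f : CompactlySupportedContinuousMap G ℂ) (γ : G),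
      coeff (φ (ofCc f)) γ = c γ * f γ := by
  choose b hb U hU hbU using exists_bisection_bump (G := G)
  -- The functional `f ↦ φ(f)(γ)` kills the kernel of evaluation at `γ`, so it is a multiple of
  -- evaluation; the factor is read off from the bump `b γ`, where `b γ γ = 1`.
  have mul : ∀ (f : CompactlySupportedContinuousMap G ℂ) (γ : G),
      coeff (φ (ofCc f)) γ = coeff (φ (ofCc (b γ))) γ * f γ := by
    intro f γ
    have h1 : (f + (-f γ) • b γ) γ = 0 := by
      change f γ + (-f γ) * b γ γ = 0
      rw [hb, mul_one, add_neg_cancel]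
    have h2 := coeff_eq_zero_of_fix hG hφ h1
    have h3 : ofCc (f + (-f γ) • b γ) = ofCc f + ofCc ((-f γ) • b γ) :=
      Subtype.ext (lam_add _ _)
    rw [h3, map_add, coeff_add, coeff_map_smul] at h2
    linear_combination h2
  have hn : ∀ γ, coeff (φ (ofCc (b γ))) γ ∈ Submonoid.unitSphere ℂ := fun γ => by
    refine mem_sphere_zero_iff_norm.2 ?_
    rw [norm_coeff_of_bisection hG hφ (hU γ) (hbU γ), hb, norm_one]
  have hb0 : ∀ γ, b γ γ ≠ 0 := fun γ => by
    rw [hb]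
    exact one_ne_zero
  have hc : Continuous fun γ => coeff (φ (ofCc (b γ))) γ := by
    rw [continuous_iff_continuousAt]
    intro γ
    have h1 : ∀ᶠ α in 𝓝 γ, b γ α ≠ 0 :=
      (b γ).continuous.continuousAt.eventually_ne (hb0 γ)
    -- The bump varies with the point, but near `γ` the factor is the quotient `φ(b γ) / b γ` for
    -- the fixed bump `b γ`.
    refine ContinuousAt.congr (f := fun α => coeff (φ (ofCc (b γ))) α / b γ α)
      ((continuous_coeff _).continuousAt.div (b γ).continuous.continuousAt
        (hb0 γ)) ?_
    filter_upwards [h1] with α hα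
    rw [mul (b γ) α, mul_div_cancel_right₀ _ hα]
  exact ⟨⟨fun γ => (⟨_, hn γ⟩ : Circle), hc.subtype_mk hn⟩, mul⟩

/-- Pointwise multiplication by a cocycle is `twist` along the identity. -/
theorem coeff_phi_one (c : cocycles G) (f : CompactlySupportedContinuousMap G ℂ) (γ : G) :
    coeff (phi 1 c (ofCc f)) γ = c.1 γ * f γ := by
  rw [phi_ofCc, coeff_ofCc]
  rfl

-- Only one arrow of `U` has the range of `α β`, namely `α`, so the convolution sum has one term.
omit [T2Space G] [LocallyCompactSpace G] in
theorem convFun_eq_of_bisection {f g : CompactlySupportedContinuousMap G ℂ} {U : Set G}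
    (hU : IsOpenBisection U) (hf : ∀ α ∉ U, f α = 0) {α β : G} (h : d α = r β) (hα : α ∈ U) :
    convFun f g (mul α β) = f α * g β := by
  rw [convFun_eq_sum (s := {α}), Finset.sum_singleton, inv_mul_cancel_left h]
  · intro γ hγ
    rw [Finset.mem_singleton.1 hγ, r_comp _ _ h]
  · intro γ hγ h0
    have hγU : γ ∈ U := by
      by_contra h'
      exact h0 (hf γ h')
    exact Finset.mem_singleton.2 (hU.injOn_r hγU hα (hγ.trans (r_comp _ _ h)))

/-- Evaluate `φ(f g) = φ(f) φ(g)` at `α β` for bumps with `f α = g β = 1`; a bisection support for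
`f` reduces both convolutions to one term. -/
theorem multiplier_mem_cocycles {φ : reducedAlg G ≃⋆ₐ[ℂ] reducedAlg G} {c : C(G, Circle)}
    (hc : ∀ (f : CompactlySupportedContinuousMap G ℂ) (γ : G),
      coeff (φ (ofCc f)) γ = c γ * f γ) : c ∈ cocycles G := by
  -- Twisting along the identity is just the pointwise product `c f`, and requires no cocycle
  -- condition on `c`.
  have key : ∀ f, φ (ofCc f) = ofCc (twist (Homeomorph.refl G) c f) := fun f =>
    coeff_injective (funext fun γ => (hc f γ).trans (coeff_ofCc (twist (Homeomorph.refl G) c f) γ).symm)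
  intro α β h
  obtain ⟨f, hf, U, hU, hfU⟩ := exists_bisection_bump α
  obtain ⟨g, hg, -⟩ := exists_bisection_bump β
  have hα : α ∈ U := by
    by_contra h'
    exact one_ne_zero (hf.symm.trans (hfU α h'))
  have h1 : ∀ f g : CompactlySupportedContinuousMap G ℂ, ofCc (conv f g) = ofCc f * ofCc g :=
    fun f g => Subtype.ext (lam_conv f g)
  have h2 := hc (conv f g) (mul α β)
  rw [h1, map_mul, key, key, ← h1, coeff_ofCc] at h2
  have h3 : conv f g (mul α β) = f α * g β := convFun_eq_of_bisection hU hfU h hα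
  have h4 : conv (twist (Homeomorph.refl G) c f) (twist (Homeomorph.refl G) c g) (mul α β)
      = (c α * f α) * (c β * g β) :=
    convFun_eq_of_bisection (f := twist (Homeomorph.refl G) c f) hU
      (fun γ hγ => by
        change (c γ : ℂ) * f γ = 0
        rw [hfU γ hγ, mul_zero]) h hα
  rw [h3, h4, hf, hg, mul_one, mul_one, mul_one, mul_one] at h2
  exact Circle.ext h2.symm

/-- Automorphisms are continuous and `C_c(G)` is dense. -/
theorem aut_ext {φ ψ : reducedAlg G ≃⋆ₐ[ℂ] reducedAlg G} (h : ∀ f, φ (ofCc f) = ψ (ofCc f)) :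
    φ = ψ := by
  have hd : Dense (Set.range (ofCc : CompactlySupportedContinuousMap G ℂ → reducedAlg G)) := by
    have : Dense {a : (reducedAlg G : Set (L2 G →L[ℂ] L2 G)) | ∃ f, ofCc f = a} := by
      rw [Subtype.dense_iff]
      refine subset_of_eq_of_subset rfl (closure_mono ?_)
      rintro _ ⟨f, rfl⟩
      exact ⟨ofCc f, ⟨f, rfl⟩, rfl⟩
    exact this
  refine DFunLike.coe_injective (Continuous.ext_on hd (continuous_reducedAlg_aut φ)
    (continuous_reducedAlg_aut ψ) ?_)
  rintro _ ⟨f, rfl⟩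
  exact h f

theorem exists_cocycle (hG : IsTopologicallyPrincipal G)
    {φ : reducedAlg G ≃⋆ₐ[ℂ] reducedAlg G} (hφ : φ ∈ fixAut (diagAlg G)) :
    ∃ c : cocycles G, phi 1 c = φ := by
  obtain ⟨c, hc⟩ := exists_multiplier hG hφ
  refine ⟨⟨c, multiplier_mem_cocycles hc⟩, aut_ext fun f => coeff_injective (funext fun γ => ?_)⟩
  rw [coeff_phi_one, hc]

theorem phi_one_mul (c c' : cocycles G) : phi 1 (c * c') = phi 1 c * phi 1 c' := by
  refine aut_ext fun f => coeff_injective (funext fun γ => ?_)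
  change _ = coeff (phi 1 c (phi 1 c' (ofCc f))) γ
  rw [coeff_phi_one, phi_ofCc 1 c', coeff_phi_one]
  change ((c.1 γ * c'.1 γ : Circle) : ℂ) * f γ = c.1 γ * (c'.1 γ * f γ)
  rw [Circle.coe_mul, mul_assoc]

theorem phi_one_injective : Function.Injective (phi (1 : autGrp G)) := by
  intro c c' h
  refine Subtype.ext (ContinuousMap.ext fun γ => ?_)
  obtain ⟨f, hf, -⟩ := exists_bisection_bump γ
  have h1 := coeff_phi_one c f γ
  rw [h, coeff_phi_one, hf, mul_one, mul_one] at h1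
  exact Circle.ext h1.symm

/-! ### When a twisted automorphism fixes the diagonal -/

omit [T2Space G] [LocallyCompactSpace G] in
theorem cocycle_unit (c : cocycles G) {x : G} (hx : x ∈ (units : Set G)) : c.1 x = 1 := by
  have h := c.2 x (d x) (r_d x).symm
  rw [mul_d, d_unit x hx] at h
  exact left_eq_mul.1 h

/-- The fixed points of a continuous map form a closed set, so testing on `C_c(G⁰)` suffices. -/
theorem mem_fixAut_diagAlg_iff {φ : reducedAlg G ≃⋆ₐ[ℂ] reducedAlg G} :
    φ ∈ fixAut (diagAlg G) ↔ ∀ h : CompactlySupportedContinuousMap G ℂ,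
      (∀ α ∉ (units : Set G), h α = 0) → φ (ofCc h) = ofCc h := by
  refine ⟨fun hφ h hh => hφ _ (ofCc_mem_diagAlg hh), fun hφ a ha => ?_⟩
  have hcl : IsClosed {a : reducedAlg G | φ a = a} :=
    isClosed_eq (continuous_reducedAlg_aut φ) continuous_id
  have hsub : ((unitRange G : Set (reducedAlg G))) ⊆ {a | φ a = a} := by
    rintro _ ⟨h, hh, rfl⟩
    exact hφ h hh
  exact closure_minimal hsub hcl ha

theorem phi_one_mem (c : cocycles G) : phi 1 c ∈ fixAut (diagAlg G) := by
  refine mem_fixAut_diagAlg_iff.2 fun h hh => coeff_injective (funext fun γ => ?_)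
  rw [coeff_phi_one, coeff_ofCc]
  by_cases hγ : γ ∈ (units : Set G)
  · rw [cocycle_unit c hγ, Circle.coe_one, one_mul]
  · rw [hh γ hγ, mul_zero]

theorem autGrp_fix_units {Φ : autGrp G} {c : cocycles G} (h : phi Φ c ∈ fixAut (diagAlg G))
    {x : G} (hx : x ∈ (units : Set G)) : Φ.1 x = x := by
  by_contra hne
  have hΦx : Φ.1 x ∈ (units : Set G) := by
    rw [← (IsGroupoidHom.map_unit Φ.2 hx).1]
    exact d_mem _
  -- If `Φ` moved `x`, a diagonal bump with value 1 at `Φ(x)` and 0 at `x` would not be fixed: its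
  -- image at `Φ(x)` is `c(x) f(x) = 0`.
  obtain ⟨f, hf1, hf2⟩ := exists_bump (G := G) (γ := Φ.1 x) (U := units ∩ {x}ᶜ)
    (isOpen_units.inter isOpen_compl_singleton) ⟨hΦx, hne⟩
  have h1 := mem_fixAut_diagAlg_iff.1 h f fun β hβ => hf2 β fun h' => hβ h'.1
  rw [phi_ofCc] at h1
  have h2 := congrFun (congrArg coeff h1) (Φ.1 x)
  rw [coeff_ofCc, coeff_ofCc, hf1] at h2
  change (c.1 (Φ.1.symm (Φ.1 x)) : ℂ) * f (Φ.1.symm (Φ.1 x)) = 1 at h2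
  rw [Homeomorph.symm_apply_apply, hf2 x (fun h' => h'.2 rfl), mul_zero] at h2
  exact zero_ne_one h2

omit [LocallyCompactSpace G] in
/-- In a topologically principal groupoid an automorphism fixing the units is trivial. -/
theorem autGrp_eq_one (hG : IsTopologicallyPrincipal G) {Φ : autGrp G}
    (h : ∀ x ∈ (units : Set G), Φ.1 x = x) : Φ = 1 := by
  refine Subtype.ext (Homeomorph.ext fun γ => ?_)
  refine congrFun (Continuous.ext_on hG.dense_arrows Φ.1.continuous continuous_id ?_) γ
  intro γ hγ
  have hd : d (Φ.1 γ) = d γ := by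
    rw [← IsGroupoidHom.map_d Φ.2, h _ (d_mem γ)]
  have hr : r (Φ.1 γ) = r γ := by
    rw [← IsGroupoidHom.map_r Φ.2, h _ (r_mem γ)]
  have h1 : d (inv γ) = r (Φ.1 γ) := (d_inv γ).trans hr.symm
  -- The arrow `γ⁻¹ Φ(γ)` lies in the isotropy at `d γ`, which is trivial.
  have h2 := hγ (mul (inv γ) (Φ.1 γ)) ((d_comp _ _ h1).trans hd)
    ((r_comp _ _ h1).trans (r_inv γ))
  have h3 := mul_inv_cancel_left (α := γ) (γ := Φ.1 γ) hr.symm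
  rw [h2, mul_d] at h3
  exact h3.symm

end FixingAutomorphisms

theorem commute_of_surjective {M N : Type*} [CommGroup M] [Group N] {f : M →* N}
    (hf : Function.Surjective f) (a b : N) : a * b = b * a := by
  obtain ⟨a, rfl⟩ := hf a
  obtain ⟨b, rfl⟩ := hf b
  rw [← map_mul, mul_comm, map_mul]

/-! ### The isomorphism between cocycles and automorphisms fixing the diagonal -/

section Isomorphism

variable {G : Type*} [TopologicalSpace G] [EtaleGroupoid G] [T2Space G] [LocallyCompactSpace G]

/-- The homomorphism `c ↦ φ_{id,c}`. -/
noncomputable def cocyclesToFixAut (G : Type*) [TopologicalSpace G] [EtaleGroupoid G] [T2Space G]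
    [LocallyCompactSpace G] : cocycles G →* fixAut (diagAlg G) :=
  MonoidHom.mk' (fun c => ⟨phi 1 c, phi_one_mem c⟩) fun c c' => Subtype.ext (phi_one_mul c c')

theorem coe_cocyclesToFixAut (c : cocycles G) : (cocyclesToFixAut G c).1 = phi 1 c := rfl

theorem cocyclesToFixAut_injective : Function.Injective (cocyclesToFixAut G) := by
  intro c c' h
  apply phi_one_injective
  rw [← coe_cocyclesToFixAut, h, coe_cocyclesToFixAut]

theorem cocyclesToFixAut_surjective (hG : IsTopologicallyPrincipal G) :
    Function.Surjective (cocyclesToFixAut G) := by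
  intro φ
  rcases φ with ⟨φ, hφ⟩
  have h := exists_cocycle hG hφ
  obtain ⟨c, hc⟩ := h
  refine ⟨c, Subtype.ext ?_⟩
  exact hc

/-- The isomorphism from cocycles to automorphisms fixing the diagonal. -/
noncomputable def cocyclesEquivFixAut (hG : IsTopologicallyPrincipal G) :
    cocycles G ≃* fixAut (diagAlg G) :=
  MulEquiv.ofBijective (cocyclesToFixAut G)
    ⟨cocyclesToFixAut_injective, cocyclesToFixAut_surjective hG⟩

end Isomorphism

end EtGrpd

theorem mainTheorem5 (G : Type*) [TopologicalSpace G] [T2Space G] [LocallyCompactSpace G]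
    [EtGrpd.EtaleGroupoid G] (hG : EtGrpd.IsTopologicallyPrincipal G) :
    (∀ (Φ : EtGrpd.autGrp G) (c : EtGrpd.cocycles G),
      Φ = 1 ↔ EtGrpd.phi Φ c ∈ EtGrpd.fixAut (EtGrpd.diagAlg G)) ∧
    (∃ e : EtGrpd.cocycles G ≃* EtGrpd.fixAut (EtGrpd.diagAlg G),
      ∀ c : EtGrpd.cocycles G,
        (e c : EtGrpd.reducedAlg G ≃⋆ₐ[ℂ] EtGrpd.reducedAlg G) = EtGrpd.phi 1 c) ∧
    (∀ φ ψ : EtGrpd.fixAut (EtGrpd.diagAlg G), φ * ψ = ψ * φ) := by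
  refine ⟨fun Φ c => ⟨?_, fun h => ?_⟩, ⟨EtGrpd.cocyclesEquivFixAut hG, EtGrpd.coe_cocyclesToFixAut⟩,
    fun φ ψ => ?_⟩
  · rintro rfl
    exact EtGrpd.phi_one_mem c
  · exact EtGrpd.autGrp_eq_one hG fun x hx => EtGrpd.autGrp_fix_units h hx
  · exact EtGrpd.commute_of_surjective (EtGrpd.cocyclesToFixAut_surjective hG) φ ψ
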